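/- **Conventions.** All vector spaces are over $\mathbb{C}$. Let $W$ be a vector space and $z,\zeta$ formal variables ($\zeta$ plays the role of $\log z$). For $\alpha\in\mathbb{C}/\mathbb{Z}$ let $\mathrm{LF}_\alpha(W)$ be the space of linear maps from $W$ to formal series $\sum_{i\ge 0}w_i(\zeta)z^{i-m}$ with $w_i(\zeta)\in W[\zeta]$, $m\in\alpha$, and let $\mathrm{LF}(W)=\bigoplus_\alpha \mathrm{LF}_\alpha(W)$ (logarithmic fields). Put $z_{12}=z_1-z_2$, $D_z=\partial_z+z^{-1}\partial_\zeta$, $D_\zeta=z\partial_z+\partial_\zeta$, $D^{(k)}=D^k/k!$. Fields $a,b\in \mathrm{LF}(W)$ are local if $z_{12}^N a(z_1)b(z_2)=z_{12}^N b(z_2)a(z_1)$ for some integer $N\ge 0$; their $n$-th product ($n\in\mathbb{Z}$) is then $(a_{(n)}b)(z)v=D_{z_1}^{(N-1-n)}\bigl(z_{12}^N a(z_1)b(z_2)v\bigr)\big|_{z_1=z_2=z,\ \zeta_1=\zeta_2=\zeta}$ for $n\le N-1$, and $0$ for $n\ge N$. Let $V$ be a vertex algebra with vacuum $\mathbf 1$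 and $\varphi$ an automorphism of $V$. A $\varphi$-twisted $V$-module is a vector space $W$ with a linear map $Y\colon V\to \mathrm{LF}(W)$ such that $Y(\mathbf 1,z)=I$, all $Y(a,z)$, $Y(b,z)$ are mutually local, $Y(\varphi a,z)=e^{2\pi \mathrm i D_\zeta}Y(a,z)$ (where $e^{2\pi \mathrm i D_\zeta}$ sends $\zeta\mapsto\zeta+2\pi \mathrm i$ and $z^\gamma\mapsto e^{2\pi \mathrm i\gamma}z^\gamma$), and $Y(a_{(n)}b,z)=Y(a,z)_{(n)}Y(b,z)$ for all $a,b\in V$, $n\in\mathbb{Z}$. **Theorem (Borcherds identity for twisted modules).** Let $V$ be a vertex algebra, $\varphi$ a locally finite automorphism of $V$, and $W$ a $\varphi$-twisted $V$-module. Write $\varphi=\sigma e^{-2\pi \mathrm i\mathcal N}$ with commuting linear operators $\sigma$, $\mathcal N$ on $V$, where $\sigma$ is semisimple (diagonalizable) and $\mathcal N$ is locally nilpotent, and put $V_\alpha=\{a\in V\mid \sigma a=e^{-2\pi \mathrm i\alpha}a\}$ for $\alpha\in\mathbb{C}/\mathbb{Z}$. The series $X(a,z)=Y(e^{\zeta\mathcal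 N}a,z)$ is independent of $\zeta$ for every $a\in V$, so that the modes $a_{(m+\mathcal N)}=\mathrm{Res}_z\, z^mX(a,z)\in\mathrm{End}(W)$ (the coefficient of $z^{-m-1}$ in $X(a,z)$) are well defined. For all $\alpha,\beta\in\mathbb{C}/\mathbb{Z}$, $a\in V_\alpha$, $b\in V_\beta$, $v\in W$, $m\in\alpha$, $k\in\beta$, $n\in\mathbb{Z}$, $$ \sum_{i=0}^\infty(-1)^i\binom{n}{i}a_{(m+n-i+\mathcal N)}\bigl(b_{(k+i+\mathcal N)}v\bigr) -\sum_{i=0}^\infty(-1)^{n+i}\binom{n}{i}b_{(k+n-i+\mathcal N)}\bigl(a_{(m+i+\mathcal N)}v\bigr) =\sum_{j=0}^\infty\Bigl(\Bigl(\binom{m+\mathcal N}{j}a\Bigr)_{(n+j)}b\Bigr)_{(m+k-j+\mathcal N)}v , $$ where $\binom{m+\mathcal N}{j}=\frac1{j!}\prod_{t=0}^{j-1}(m-t+\mathcal N)$, and all three sums are finite. In particular, for $n=0$, $$ \bigl[a_{(m+\mathcal N)},b_{(k+\mathcal N)}\bigr]v=\sum_{j=0}^\infty\Bigl(\Bigl(\binom{m+\mathcal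 N}{j}a\Bigr)_{(j)}b\Bigr)_{(m+k-j+\mathcal N)}v . $$ -/

import Mathlib

noncomputable section

namespace TwistedVertex

universe u v

/-! ### Vertex algebras -/

/-- A vertex algebra structure on a complex vector space `V`: a vacuum vector and a linear
state-field correspondence `Y` with values in the quantum fields `Hom(V, V((z)))`. The mode `a_(n)`,
i.e. the coefficient of `z ^ (-n-1)` in `Y(a, z)`, is `VertexOperator.ncoeff (Y a) n`. -/
structure VertexAlgebra (V : Type u) [AddCommGroup V] [Module ℂ V] where
  /-- the vacuum vector -/
  vac : V
  /-- the state-field correspondence -/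
  Y : V →ₗ[ℂ] VertexOperator ℂ V
  /-- `Y(vac, z)` is the identity operator -/
  vac_mode : ∀ (n : ℤ) (b : V), VertexOperator.ncoeff (Y vac) n b = if n = -1 then b else 0
  /-- `Y(a, z) vac` has no negative powers of `z` -/
  mode_vac : ∀ (a : V) (n : ℤ), 0 ≤ n → VertexOperator.ncoeff (Y a) n vac = 0
  /-- `Y(a, z) vac` has constant term `a` -/
  creation : ∀ a : V, VertexOperator.ncoeff (Y a) (-1) vac = a
  /-- translation covariance `[T, Y(a, z)] = ∂_z Y(a, z)` for `T a = a_(-2) vac` -/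
  translation : ∀ (a b : V) (n : ℤ),
    VertexOperator.ncoeff (Y (VertexOperator.ncoeff (Y a) n b)) (-2) vac
        - VertexOperator.ncoeff (Y a) n (VertexOperator.ncoeff (Y b) (-2) vac)
      = (-n : ℂ) • VertexOperator.ncoeff (Y a) (n - 1) b
  /-- locality: `(z₁ - z₂) ^ N [Y(a, z₁), Y(b, z₂)] = 0` for some `N` -/
  locality : ∀ a b : V, ∃ N : ℕ, ∀ (m k : ℤ) (c : V),
    ∑ i ∈ Finset.range (N + 1), ((-1 : ℂ) ^ i * (N.choose i : ℂ)) •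
        VertexOperator.ncoeff (Y a) (m + N - i) (VertexOperator.ncoeff (Y b) (k + i) c)
      = ∑ i ∈ Finset.range (N + 1), ((-1 : ℂ) ^ i * (N.choose i : ℂ)) •
        VertexOperator.ncoeff (Y b) (k + i) (VertexOperator.ncoeff (Y a) (m + N - i) c)

section

variable {V : Type u} [AddCommGroup V] [Module ℂ V]

/-- The `n`-th product `a_(n) b` in a vertex algebra. -/
def VertexAlgebra.prod (𝒱 : VertexAlgebra V) (n : ℤ) (a b : V) : V :=
  VertexOperator.ncoeff (𝒱.Y a) n b

/-- An invertible linear operator is an automorphism if it preserves all `n`-th products. -/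
def IsAutomorphism (𝒱 : VertexAlgebra V) (φ : V ≃ₗ[ℂ] V) : Prop :=
  ∀ (a b : V) (n : ℤ), φ (𝒱.prod n a b) = 𝒱.prod n (φ a) (φ b)

/-- Every vector lies in a finite-dimensional invariant subspace. -/
def IsLocallyFinite (φ : V →ₗ[ℂ] V) : Prop :=
  ∀ a : V, ∃ U : Submodule ℂ V, FiniteDimensional ℂ U ∧ a ∈ U ∧ ∀ u ∈ U, φ u ∈ U

def IsLocallyNilpotent (N : Module.End ℂ V) : Prop :=
  ∀ a : V, ∃ l : ℕ, 1 ≤ l ∧ (N ^ l) a = 0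

/-- A (possibly infinite-dimensional) operator is semisimple if it is diagonalizable,
i.e. its eigenvectors span the space. -/
def IsDiagonalizable (σ : Module.End ℂ V) : Prop :=
  ⨆ μ : ℂ, Module.End.eigenspace σ μ = ⊤

/-- `e ^ (c N) a = ∑ₗ (cˡ / l!) Nˡ a`; the sum is finite when `N` is locally nilpotent. -/
def expApply (c : ℂ) (N : Module.End ℂ V) (a : V) : V :=
  ∑ᶠ l : ℕ, (c ^ l / (l.factorial : ℂ)) • (N ^ l) a

/-- `φ = σ e ^ (-2πi N)` with commuting semisimple `σ` and locally nilpotent `N`. -/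
structure IsJordanDecomposition (φ : V →ₗ[ℂ] V) (σ N : Module.End ℂ V) : Prop where
  semisimple : IsDiagonalizable σ
  locallyNilpotent : IsLocallyNilpotent N
  commute : Commute σ N
  eq : ∀ a : V, φ a = σ (expApply (-(2 * Real.pi * Complex.I)) N a)

/-- The group `ℂ / ℤ`. -/
abbrev CModZ : Type := ℂ ⧸ AddSubgroup.zmultiples (1 : ℂ)

/-- `V_α`, the eigenspace of `σ` with eigenvalue `e ^ (-2πi α)` for `α ∈ ℂ / ℤ`
(the eigenvalue is the same for all representatives `m ∈ α`). -/
def cosetEigenspace (σ : Module.End ℂ V) (α : CModZ) : Submodule ℂ V :=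
  ⨅ (m : ℂ) (_ : (m : CModZ) = α),
    Module.End.eigenspace σ (Complex.exp (-(2 * Real.pi * Complex.I * m)))

/-- The operator `binom(m + N, j) = (m + N)(m + N - 1) ⋯ (m + N - j + 1) / j!` on `V`. -/
def binomOp (N : Module.End ℂ V) (m : ℂ) (j : ℕ) : Module.End ℂ V :=
  ((j.factorial : ℂ)⁻¹) • Polynomial.aeval (algebraMap ℂ (Module.End ℂ V) m + N) (descPochhammer ℂ j)

end

/-! ### Logarithmic fields

A formal series `∑_γ w_γ(ζ) z ^ γ` with exponents `γ ∈ ℂ` and coefficients `w_γ ∈ W[ζ]` is the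
function `γ ↦ w_γ`, where `W[ζ]` is `PolynomialModule ℂ W`. -/

section

variable (W : Type v) [AddCommGroup W] [Module ℂ W]

abbrev LogSeries : Type v := ℂ → PolynomialModule ℂ W

/-- `LF_α(W)`: linear maps from `W` to the series `∑_{i ≥ 0} w_i(ζ) z ^ (i - m)` with `m ∈ α`
(where `m` may depend on the vector to which the map is applied). -/
def LFcoset (α : CModZ) : Submodule ℂ (W →ₗ[ℂ] LogSeries W) where
  carrier := {A | ∀ v : W, ∃ m : ℂ, (m : CModZ) = α ∧
    ∀ γ : ℂ, A v γ ≠ 0 → ∃ i : ℕ, γ = i - m}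
  zero_mem' := by
    intro v
    obtain ⟨m, hm⟩ := QuotientAddGroup.mk_surjective α
    exact ⟨m, hm, fun γ h => absurd rfl h⟩
  add_mem' := by
    intro A B hA hB v
    obtain ⟨m, hm, h1⟩ := hA v
    obtain ⟨k, hk, h2⟩ := hB v
    have hmk : (m : CModZ) = (k : CModZ) := hm.trans hk.symm
    obtain ⟨t, ht⟩ := AddSubgroup.mem_zmultiples_iff.1 (QuotientAddGroup.eq.1 hmk)
    have ht' : k = m + t := by
      have : (t : ℂ) = -m + k := by simpa using ht
      rw [this]; ring
    refine ⟨m + (t.toNat : ℂ), ?_, ?_⟩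
    · rw [← hm, eq_comm]
      refine QuotientAddGroup.eq.2 (AddSubgroup.mem_zmultiples_iff.2 ⟨(t.toNat : ℤ), ?_⟩)
      rw [zsmul_one]
      push_cast
      ring
    · intro γ hγ
      by_cases hAγ : A v γ = 0
      · have hBγ : B v γ ≠ 0 := fun h => hγ (by simp [hAγ, h])
        obtain ⟨i, hi⟩ := h2 γ hBγ
        have hz : ((i + (t.toNat - t).toNat : ℕ) : ℤ) = i + t.toNat - t := by omega
        refine ⟨i + (t.toNat - t).toNat, ?_⟩
        have hc : ((i + (t.toNat - t).toNat : ℕ) : ℂ) = i + (t.toNat : ℂ) - t := by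
          exact_mod_cast congrArg (fun x : ℤ => (x : ℂ)) hz
        rw [hc, hi, ht']; ring
      · obtain ⟨i, hi⟩ := h1 γ hAγ
        exact ⟨i + t.toNat, by rw [hi]; push_cast; ring⟩
  smul_mem' := by
    intro c A hA v
    obtain ⟨m, hm, h1⟩ := hA v
    exact ⟨m, hm, fun γ hγ => h1 γ fun h => hγ (by simp [h])⟩

/-- `LF(W)`, the sum of the spaces `LF_α(W)` inside all linear maps from `W` to formal series
(the sum is direct, since exponents from different cosets are distinct). -/
def LF : Submodule ℂ (W →ₗ[ℂ] LogSeries W) := ⨆ α : CModZ, LFcoset W α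

/-- Formal series `∑ F(γ₁, γ₂, p, q) z₁ ^ γ₁ z₂ ^ γ₂ ζ₁ ^ p ζ₂ ^ q` with coefficients in `W`. -/
abbrev LogSeries₂ : Type v := ℂ → ℂ → ℕ → ℕ → W

/-- Multiplication by `z₁₂ = z₁ - z₂`. -/
def mulZ₁₂ : Module.End ℂ (LogSeries₂ W) where
  toFun F := fun γ₁ γ₂ p q => F (γ₁ - 1) γ₂ p q - F γ₁ (γ₂ - 1) p q
  map_add' F G := by
    funext γ₁ γ₂ p q
    simp only [Pi.add_apply]
    abel
  map_smul' c F := by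
    funext γ₁ γ₂ p q
    simp [smul_sub]

/-- The derivation `D_{z₁} = ∂_{z₁} + z₁⁻¹ ∂_{ζ₁}`. -/
def Dz₁ : Module.End ℂ (LogSeries₂ W) where
  toFun F := fun γ₁ γ₂ p q =>
    (γ₁ + 1) • F (γ₁ + 1) γ₂ p q + ((p : ℂ) + 1) • F (γ₁ + 1) γ₂ (p + 1) q
  map_add' F G := by
    funext γ₁ γ₂ p q
    simp only [Pi.add_apply, smul_add]
    abel
  map_smul' c F := by
    funext γ₁ γ₂ p q
    simp only [Pi.smul_apply, RingHom.id_apply, smul_add, smul_comm c]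

end

section

variable {W : Type v} [AddCommGroup W] [Module ℂ W]

/-- The identity operator `I` as a field: `I w = w z⁰ ζ⁰`. -/
def idField (w : W) : LogSeries W := fun γ => if γ = 0 then PolynomialModule.single ℂ 0 w else 0

/-- `a(z₁) b(z₂) v`. -/
def comp₁₂ (A B : LF W) (v : W) : LogSeries₂ W :=
  fun γ₁ γ₂ p q => (A.1 ((B.1 v γ₂).coeff q) γ₁).coeff p

/-- `b(z₂) a(z₁) v`. -/
def comp₂₁ (A B : LF W) (v : W) : LogSeries₂ W :=
  fun γ₁ γ₂ p q => (B.1 ((A.1 v γ₁).coeff p) γ₂).coeff q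

/-- `z₁₂ ^ N a(z₁) b(z₂) = z₁₂ ^ N b(z₂) a(z₁)`. -/
def LocalOfOrder (N : ℕ) (A B : LF W) : Prop :=
  ∀ v : W, (mulZ₁₂ W ^ N) (comp₁₂ A B v) = (mulZ₁₂ W ^ N) (comp₂₁ A B v)

/-- The pair `(a, b)` of logarithmic fields is local. -/
def IsLocalPair (A B : LF W) : Prop := ∃ N : ℕ, LocalOfOrder N A B

/-- The coefficient of `z ^ γ ζ ^ r` in `F |_{z₁ = z₂ = z, ζ₁ = ζ₂ = ζ}`. -/
def diagCoeff (F : LogSeries₂ W) (γ : ℂ) (r : ℕ) : W :=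
  ∑ᶠ γ₁ : ℂ, ∑ pq ∈ Finset.HasAntidiagonal.antidiagonal r, F γ₁ (γ - γ₁) pq.1 pq.2

/-- `C` is the `n`-th product `a_(n) b` of the local logarithmic fields `A = a`, `B = b`: for some
`N` with `z₁₂ ^ N a(z₁) b(z₂) = z₁₂ ^ N b(z₂) a(z₁)`, either `n ≥ N` and `C = 0`, or `n ≤ N - 1` and
`C v = D_{z₁}^{(N-1-n)} (z₁₂ ^ N a(z₁) b(z₂) v)` restricted to `z₁ = z₂ = z`, `ζ₁ = ζ₂ = ζ`,
where `D^{(k)} = D ^ k / k!`. -/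
def IsNthProduct (A B : LF W) (n : ℤ) (C : LF W) : Prop :=
  ∃ N : ℕ, LocalOfOrder N A B ∧
    ((N : ℤ) ≤ n → C = 0) ∧
    ∀ k : ℕ, (k : ℤ) = N - 1 - n → ∀ (v : W) (γ : ℂ) (r : ℕ),
      (C.1 v γ).coeff r =
        diagCoeff (((k.factorial : ℂ)⁻¹) • (Dz₁ W ^ k) ((mulZ₁₂ W ^ N) (comp₁₂ A B v))) γ r

/-- The monodromy operator `e ^ (2πi D_ζ)`, with `D_ζ = z ∂_z + ∂_ζ`, on formal series: it sends
`ζ` to `ζ + 2πi` and `z ^ γ` to `e ^ (2πi γ) z ^ γ`. -/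
def monodromy (f : LogSeries W) : LogSeries W := fun γ =>
  Complex.exp (2 * Real.pi * Complex.I * γ) •
    PolynomialModule.comp (Polynomial.X + Polynomial.C (2 * Real.pi * Complex.I)) (f γ)

end

/-! ### Twisted modules and their modes -/

/-- The structure of a `φ`-twisted module over the vertex algebra `𝒱` on a vector space `W`. -/
structure TwistedModule {V : Type u} [AddCommGroup V] [Module ℂ V] (𝒱 : VertexAlgebra V)
    (φ : V ≃ₗ[ℂ] V) (W : Type v) [AddCommGroup W] [Module ℂ W] where
  /-- the fields `Y(a, z)` -/
  Y : V →ₗ[ℂ] LF W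
  /-- `Y(vac, z) = I` -/
  vac : ∀ w : W, (Y 𝒱.vac).1 w = idField w
  /-- `Y(V)` is a local collection -/
  isLocal : ∀ a b : V, IsLocalPair (Y a) (Y b)
  /-- `Y(φ a, z) = e ^ (2πi D_ζ) Y(a, z)` -/
  equivariance : ∀ (a : V) (w : W), (Y (φ a)).1 w = monodromy ((Y a).1 w)
  /-- `Y(a_(n) b, z) = Y(a, z)_(n) Y(b, z)` -/
  nthProduct : ∀ (a b : V) (n : ℤ), IsNthProduct (Y a) (Y b) n (Y (𝒱.prod n a b))

section

variable {V : Type u} [AddCommGroup V] [Module ℂ V] {𝒱 : VertexAlgebra V} {φ : V ≃ₗ[ℂ] V}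
  {W : Type v} [AddCommGroup W] [Module ℂ W]

/-- The coefficient of `z ^ γ` in `X(a, z) = Y(z ^ N a, z)`, where `z ^ N a = e ^ (ζ N) a` and `Y` is
extended `ζ`-linearly: `∑ₗ (ζˡ / l!) ⋅ [z ^ γ] Y(Nˡ a, z)`, a linear map from `W` to `W[ζ]`. -/
def TwistedModule.Xcoeff (M : TwistedModule 𝒱 φ W) (N : Module.End ℂ V) (a : V) (γ : ℂ) :
    W →ₗ[ℂ] PolynomialModule ℂ W :=
  ∑ᶠ l : ℕ,
    ((l.factorial : ℂ)⁻¹) •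
      (Algebra.lsmul ℂ ℂ (PolynomialModule ℂ W) ((Polynomial.X : Polynomial ℂ) ^ l) ∘ₗ
        (LinearMap.proj γ : LogSeries W →ₗ[ℂ] PolynomialModule ℂ W) ∘ₗ (M.Y ((N ^ l) a)).1)

/-- The mode `a_(m + N) = Res_z z ^ m X(a, z)`, i.e. the coefficient of `z ^ (-m-1)` in `X(a, z)`.
This coefficient does not depend on `ζ`; the operator on `W` is obtained by evaluating at `ζ = 0`. -/
def TwistedModule.mode (M : TwistedModule 𝒱 φ W) (N : Module.End ℂ V) (a : V) (m : ℂ) :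
    Module.End ℂ W :=
  (PolynomialModule.eval (0 : ℂ)) ∘ₗ M.Xcoeff N a (-m - 1)

end

end TwistedVertex

end

/-!
The argument rests on the fact that only the coefficients of `ζ ^ 0` are visible in the Borcherds
identity, the other powers of `ζ` being encoded by the operator `N`.

*Independence of `ζ`.* If `σ a = μ a`, then equivariance under `φ = σ e^{-2πi N}` turns into
`e^{2πi γ} X_γ(ζ + 2πi) = μ X_γ(ζ)` for the coefficient `X_γ(ζ) ∈ W[ζ]` of `z ^ γ` in `X(a, z) v`
(`monodromy_Xcoeff`). Comparing the two leading coefficients shows that a nonzero polynomial with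
this property is constant and that `e^{2πi γ} = μ` (`eq_and_coeff_eq_zero_of_quasiperiodic`). As the
eigenvectors of `σ` span, `X(a, z)` is constant in `ζ` for all `a`. Hence a mode of `X(a, z)` is the
coefficient of `ζ ^ 0` in `Y(a, z)` (`mode_apply`), and `∂_ζ Y(a, z) = -Y(N a, z)`
(`succ_smul_coeff_succ`). On coefficients of `ζ ^ 0`, the derivation `D_z` therefore acts as
`∂_z - z⁻¹ N` (`Dz₁_pow_apply`).

*The left-hand side.* For `a ∈ V_α` and `m ∈ α`, the exponents of `z` in `Y(a, z)` lie in `-m + ℤ`.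
Put `h_a = z₁₂ ^ L Y(a, z₁) Y(b, z₂) v` with `L` an order of locality larger than `n`, and
`K = L - 1 - n`. The left-hand side is the residue of `z₁ ^ m z₂ ^ k` times the difference of the
two expansions of `z₁₂ ^ (-1-K)`, applied to `h_a`. That is the residue of the restriction of
`z₂ ^ k ∂_{z₁}^{(K)} (z₁ ^ m h_a)` to the diagonal, in coefficients a sum over `y : ℤ` with weights
`binom(y, K)` (`finsum_expansion_sub_finsum_expansion`).

*The right-hand side.* The `n`-th product may be computed with any order of locality
(`IsNthProduct.coeff_eq`), because `D^{(k+1)} z₁₂ = z₁₂ D^{(k+1)} + D^{(k)}` and multiples of `z₁₂`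
vanish on the diagonal. Locality of `Y(a, z)` and `Y(b, z)` of order `L` is inherited by `N a`, so
the order `L` serves for all the vectors `binom(m + N, j) a`. The term with index `j` becomes a sum
over `y : ℤ` of coefficients of `h` at `binom(y - m - N, K - j) binom(m + N, j) a` (`mode_prod`),
and the Vandermonde identity for operators (`sum_binomOp_mul_binomOp`) adds these up to the sum
above (`finsum_mode_prod`).
-/

noncomputable section

namespace TwistedVertex

universe u v

/-! ### Quasi-periodic polynomials -/

section
variable {W : Type v} [AddCommGroup W] [Module ℂ W]

/-- Taylor expansion of `p(X + h)`. -/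
lemma coeff_comp_X_add_C (h : ℂ) (p : PolynomialModule ℂ W) (n : ℕ) :
    (PolynomialModule.comp (Polynomial.X + Polynomial.C h) p).coeff n =
      p.coeff.sum fun i w => (h ^ (i - n) * (i.choose n : ℂ)) • w := by
  induction p using PolynomialModule.induction_linear with
  | zero => simp
  | add x y hx hy =>
    rw [map_add, PolynomialModule.coeff_add, Finsupp.add_apply, hx, hy, PolynomialModule.coeff_add,
      Finsupp.sum_add_index' (fun _ => smul_zero _) (fun _ _ _ => smul_add _ _ _)]
  | single i w =>
    rw [PolynomialModule.comp_single, PolynomialModule.smul_single_apply,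
      PolynomialModule.coeff_single,
      Finsupp.sum_single_index (h := fun i w => (h ^ (i - n) * (i.choose n : ℂ)) • w) (smul_zero _),
      if_pos n.zero_le, Nat.sub_zero, Polynomial.coeff_X_add_C_pow]

lemma coeff_smul_eq (c : ℂ) (f : PolynomialModule ℂ W) : (c • f).coeff = c • f.coeff := rfl

lemma C_smul_eq (c : ℂ) (f : PolynomialModule ℂ W) : Polynomial.C c • f = c • f := by
  rw [← Polynomial.algebraMap_eq, algebraMap_smul]

lemma coeff_smul_X_pow_smul (c : ℂ) (l : ℕ) (f : PolynomialModule ℂ W) (n : ℕ) :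
    (c • ((Polynomial.X : Polynomial ℂ) ^ l • f)).coeff n =
      if l ≤ n then c • f.coeff (n - l) else 0 := by
  rw [← C_smul_eq, smul_smul, Polynomial.C_mul_X_pow_eq_monomial,
    PolynomialModule.monomial_smul_apply]

/-- A nonzero polynomial `p` with `e p(X + h) = μ p` is constant: the leading coefficients give
`e = μ`, and the next ones give `deg p * h = 0`. -/
lemma eq_and_coeff_eq_zero_of_quasiperiodic {h e μ : ℂ} (hh : h ≠ 0) (he : e ≠ 0)
    {p : PolynomialModule ℂ W} (hp : p ≠ 0)
    (H : e • PolynomialModule.comp (Polynomial.X + Polynomial.C h) p = μ • p) :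
    e = μ ∧ ∀ n, n ≠ 0 → p.coeff n = 0 := by
  have hne : p.coeff.support.Nonempty := by
    rw [Finsupp.support_nonempty_iff]
    exact fun h0 => hp (PolynomialModule.coeff_eq_zero.1 h0)
  set d := p.coeff.support.max' hne with hd
  have hd0 : p.coeff d ≠ 0 := Finsupp.mem_support_iff.1 (Finset.max'_mem _ hne)
  have hsub : p.coeff.support ⊆ Finset.range (d + 1) := fun i hi =>
    Finset.mem_range.2 (Nat.lt_succ_of_le (Finset.le_max' _ i hi))
  have key : ∀ n, e • ∑ i ∈ Finset.range (d + 1), (h ^ (i - n) * (i.choose n : ℂ)) • p.coeff i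
      = μ • p.coeff n := by
    intro n
    rw [← Finsupp.sum_of_support_subset p.coeff hsub
      (fun i w => (h ^ (i - n) * (i.choose n : ℂ)) • w) (fun _ _ => smul_zero _),
      ← coeff_comp_X_add_C]
    exact congrArg (fun q : PolynomialModule ℂ W => q.coeff n) H
  have hlow : ∀ n, ∑ i ∈ Finset.range n, (h ^ (i - n) * (i.choose n : ℂ)) • p.coeff i = 0 :=
    fun n => Finset.sum_eq_zero fun i hi => by
      rw [Nat.choose_eq_zero_of_lt (Finset.mem_range.1 hi)]; simp
  have heμ : e = μ := by
    have := key d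
    rw [Finset.sum_range_succ, hlow] at this
    simp only [zero_add, Nat.sub_self, pow_zero, Nat.choose_self, Nat.cast_one, mul_one,
      one_smul] at this
    exact smul_left_injective ℂ hd0 this
  refine ⟨heμ, fun n hn => ?_⟩
  have hdz : d = 0 := by
    rcases Nat.eq_zero_or_eq_succ_pred d with h0 | h0
    · exact h0
    exfalso
    generalize d.pred = d' at h0
    have := key d'
    rw [h0, Finset.sum_range_succ, Finset.sum_range_succ, hlow, ← heμ] at this
    have h1 := smul_right_injective W he this
    simp only [zero_add, Nat.sub_self, pow_zero, Nat.choose_self, Nat.cast_one, mul_one,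
      one_smul, add_eq_left, Nat.choose_succ_self_right] at h1
    rw [← Nat.succ_eq_add_one, ← h0, smul_eq_zero] at h1
    rcases h1 with h1 | h1
    · rw [h0, Nat.succ_eq_add_one, Nat.add_sub_cancel_left, pow_one] at h1
      rcases mul_eq_zero.1 h1 with h2 | h2
      · exact hh h2
      · exact Nat.succ_ne_zero d' (Nat.cast_eq_zero.1 h2)
    · exact hd0 h1
  by_contra hc
  have := Finset.mem_range.1 (hsub (Finsupp.mem_support_iff.2 hc))
  omega

/-- The identity `e^{-hN} e^{(ζ + h)N} = e^{ζN}`, applied to a sequence `y n = N ^ n a` that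
vanishes from `L` on. -/
lemma sum_exp_shift {L : ℕ} (h : ℂ) (y : ℕ → PolynomialModule ℂ W) (hy : ∀ n, L ≤ n → y n = 0) :
    ∑ l ∈ Finset.range L, ((l.factorial : ℂ)⁻¹) •
      ((Polynomial.X + Polynomial.C h) ^ l •
        ∑ i ∈ Finset.range L, ((-h) ^ i / (i.factorial : ℂ)) • y (i + l))
    = ∑ n ∈ Finset.range L, ((n.factorial : ℂ)⁻¹) • ((Polynomial.X : Polynomial ℂ) ^ n • y n) := by
  have h1 : ∀ l ∈ Finset.range L, ((l.factorial : ℂ)⁻¹) •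
      ((Polynomial.X + Polynomial.C h) ^ l •
        ∑ i ∈ Finset.range L, ((-h) ^ i / (i.factorial : ℂ)) • y (i + l))
      = ∑ i ∈ Finset.range (L - l), ((l.factorial : ℂ)⁻¹) •
      ((Polynomial.X + Polynomial.C h) ^ l • (((-h) ^ i / (i.factorial : ℂ)) • y (l + i))) := by
    intro l _
    rw [Finset.smul_sum, Finset.smul_sum]
    symm
    refine Finset.sum_subset_zero_on_sdiff (Finset.range_mono (Nat.sub_le _ _)) ?_ ?_
    · intro i hi
      rw [Finset.mem_sdiff, Finset.mem_range, Finset.mem_range] at hi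
      rw [hy (i + l) (by omega)]; simp
    · intro i _
      rw [add_comm l i]
  rw [Finset.sum_congr rfl h1, ← Finset.sum_range_diag_flip L fun l i => ((l.factorial : ℂ)⁻¹) •
      ((Polynomial.X + Polynomial.C h) ^ l • (((-h) ^ i / (i.factorial : ℂ)) • y (l + i)))]
  refine Finset.sum_congr rfl fun n _ => ?_
  have hX : (Polynomial.X : Polynomial ℂ) = (Polynomial.X + Polynomial.C h) + Polynomial.C (-h) := by
    simp
  conv_rhs => rw [hX, add_pow]
  rw [Finset.sum_smul, Finset.smul_sum]
  refine Finset.sum_congr rfl fun l hl => ?_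
  have hl' : l ≤ n := Nat.lt_succ_iff.1 (Finset.mem_range.1 hl)
  rw [Nat.add_sub_cancel' hl', mul_assoc, mul_smul,
    ← Polynomial.C_pow, ← Polynomial.C_eq_natCast, ← Polynomial.C_mul,
    C_smul_eq, smul_comm _ (_ * _ : ℂ) (y n), smul_smul,
    Nat.cast_choose ℂ hl', smul_comm _ (_ / _ : ℂ) (y n), smul_smul]
  congr 1
  have := Nat.cast_ne_zero (R := ℂ).2 n.factorial_ne_zero
  field_simp

end

/-! ### The dependence of the fields on `ζ` -/

section
variable {V : Type u} [AddCommGroup V] [Module ℂ V] {𝒱 : VertexAlgebra V} {φ : V ≃ₗ[ℂ] V}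
  {W : Type v} [AddCommGroup W] [Module ℂ W]

lemma pow_apply_eq_zero_of_le {N : Module.End ℂ V} {a : V} {L l : ℕ} (h : (N ^ L) a = 0)
    (hl : L ≤ l) : (N ^ l) a = 0 := by
  rw [← Nat.sub_add_cancel hl, pow_add, Module.End.mul_apply, h, map_zero]

lemma expApply_eq_sum (c : ℂ) {N : Module.End ℂ V} {a : V} {L : ℕ} (h : (N ^ L) a = 0) :
    expApply c N a = ∑ l ∈ Finset.range L, (c ^ l / (l.factorial : ℂ)) • (N ^ l) a := by
  refine finsum_eq_sum_of_support_subset _ fun l hl => ?_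
  rw [Finset.coe_range, Set.mem_Iio]
  by_contra hc
  exact hl (by simp only; rw [pow_apply_eq_zero_of_le h (not_lt.1 hc), smul_zero])

lemma apply_mem_cosetEigenspace {σ N : Module.End ℂ V} (h : Commute σ N) {α : CModZ} {a : V}
    (ha : a ∈ cosetEigenspace σ α) : N a ∈ cosetEigenspace σ α := by
  refine (Submodule.mem_iInf _).2 fun m => (Submodule.mem_iInf _).2 fun hm => ?_
  have h1 := Module.End.mem_eigenspace_iff.1
    ((Submodule.mem_iInf _).1 ((Submodule.mem_iInf _).1 ha m) hm)
  rw [Module.End.mem_eigenspace_iff, ← Module.End.mul_apply, h.eq, Module.End.mul_apply, h1,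
    map_smul]

namespace TwistedModule
variable (M : TwistedModule 𝒱 φ W)

lemma Xcoeff_apply {N : Module.End ℂ V} {a : V} {L : ℕ} (h : (N ^ L) a = 0) (γ : ℂ) (w : W) :
    M.Xcoeff N a γ w = ∑ l ∈ Finset.range L, ((l.factorial : ℂ)⁻¹) •
      ((Polynomial.X : Polynomial ℂ) ^ l • (M.Y ((N ^ l) a)).1 w γ) := by
  rw [Xcoeff, finsum_eq_sum_of_support_subset (s := Finset.range L)]
  · rw [LinearMap.sum_apply]; rfl
  · intro l hl
    rw [Finset.coe_range, Set.mem_Iio]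
    by_contra hc
    refine hl ?_
    simp only
    rw [pow_apply_eq_zero_of_le h (not_lt.1 hc)]
    ext; simp

/-- Monodromy acts on `X(a, z)` by the scalar by which `σ` acts on `a`: the unipotent part
of the automorphism cancels against the shift of `ζ` in `e^{ζN}`. -/
lemma monodromy_Xcoeff {σ N : Module.End ℂ V} (hdec : IsJordanDecomposition φ.toLinearMap σ N)
    {μ : ℂ} {a : V} (ha : σ a = μ • a) (γ : ℂ) (w : W) :
    Complex.exp (2 * Real.pi * Complex.I * γ) • PolynomialModule.comp
      (Polynomial.X + Polynomial.C (2 * Real.pi * Complex.I)) (M.Xcoeff N a γ w)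
      = μ • M.Xcoeff N a γ w := by
  obtain ⟨L, -, hL⟩ := hdec.locallyNilpotent a
  have hσ : ∀ n, σ ((N ^ n) a) = μ • (N ^ n) a := fun n => by
    have := congrArg (fun f : Module.End ℂ V => f a) (hdec.commute.pow_right n).eq
    simp only [Module.End.mul_apply] at this
    rw [this, ha, map_smul]
  have hφ : ∀ l, φ ((N ^ l) a) = μ • ∑ i ∈ Finset.range L,
      ((-(2 * Real.pi * Complex.I)) ^ i / (i.factorial : ℂ)) • (N ^ (i + l)) a := fun l => by
    have hl : (N ^ L) ((N ^ l) a) = 0 := by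
      rw [← Module.End.mul_apply, ← pow_add, pow_apply_eq_zero_of_le hL (Nat.le_add_right _ _)]
    have h1 := hdec.eq ((N ^ l) a)
    rw [expApply_eq_sum _ hl, map_sum] at h1
    refine h1.trans ?_
    rw [Finset.smul_sum]
    refine Finset.sum_congr rfl fun i _ => ?_
    rw [map_smul, ← Module.End.mul_apply (N ^ i), ← pow_add, hσ, smul_comm]
  rw [M.Xcoeff_apply hL]
  conv_rhs => rw [← sum_exp_shift (2 * Real.pi * Complex.I) (fun n => (M.Y ((N ^ n) a)).1 w γ) (fun n hn => by
      rw [pow_apply_eq_zero_of_le hL hn]; simp)]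
  rw [map_sum, Finset.smul_sum, Finset.smul_sum]
  refine Finset.sum_congr rfl fun l _ => ?_
  have h2 := congrFun (M.equivariance ((N ^ l) a) w) γ
  rw [hφ] at h2
  simp only [monodromy] at h2
  rw [map_smul, PolynomialModule.comp_smul, Polynomial.X_pow_comp, smul_comm _ (_⁻¹ : ℂ),
    smul_comm μ, smul_comm (Complex.exp _) (_ ^ l : Polynomial ℂ), ← h2,
    smul_comm μ (_ ^ l : Polynomial ℂ)]
  simp

/-- `X(a, z)` does not depend on `ζ`. -/
lemma coeff_Xcoeff {σ N : Module.End ℂ V} (hdec : IsJordanDecomposition φ.toLinearMap σ N)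
    (a : V) (γ : ℂ) (w : W) {n : ℕ} (hn : n ≠ 0) : (M.Xcoeff N a γ w).coeff n = 0 := by
  have ha : a ∈ ⨆ μ : ℂ, Module.End.eigenspace σ μ := by
    rw [hdec.semisimple]; trivial
  induction ha using Submodule.iSup_induction' with
  | mem μ x hx =>
    by_cases h0 : M.Xcoeff N x γ w = 0
    · simp [h0]
    · exact (eq_and_coeff_eq_zero_of_quasiperiodic Complex.two_pi_I_ne_zero (Complex.exp_ne_zero _)
        h0 (M.monodromy_Xcoeff hdec (Module.End.mem_eigenspace_iff.1 hx) γ w)).2 n hn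
  | zero => rw [M.Xcoeff_apply (L := 0) (by simp)]; simp
  | add x y _ _ hx hy =>
    obtain ⟨Lx, -, hLx⟩ := hdec.locallyNilpotent x
    obtain ⟨Ly, -, hLy⟩ := hdec.locallyNilpotent y
    have h1 := pow_apply_eq_zero_of_le hLx (Nat.le_add_right Lx Ly)
    have h2 := pow_apply_eq_zero_of_le hLy (Nat.le_add_left Ly Lx)
    have h3 : (N ^ (Lx + Ly)) (x + y) = 0 := by rw [map_add, h1, h2, add_zero]
    rw [M.Xcoeff_apply h1] at hx
    rw [M.Xcoeff_apply h2] at hy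
    rw [M.Xcoeff_apply h3]
    simp only [map_add, Submodule.coe_add, LinearMap.add_apply, Pi.add_apply, smul_add,
      Finset.sum_add_distrib, PolynomialModule.coeff_add, Finsupp.add_apply, hx, hy, add_zero]

lemma coeff_zero_Xcoeff {σ N : Module.End ℂ V} (hdec : IsJordanDecomposition φ.toLinearMap σ N)
    (a : V) (γ : ℂ) (w : W) : (M.Xcoeff N a γ w).coeff 0 = ((M.Y a).1 w γ).coeff 0 := by
  obtain ⟨L, hL1, hL⟩ := hdec.locallyNilpotent a
  rw [M.Xcoeff_apply hL, PolynomialModule.coeff_sum, Finsupp.finsetSum_apply,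
    Finset.sum_eq_single 0]
  · simp
  · intro l _ hl
    rw [coeff_smul_X_pow_smul, if_neg (by omega)]
  · intro h; simp at h; omega

lemma Xcoeff_eq_single {σ N : Module.End ℂ V} (hdec : IsJordanDecomposition φ.toLinearMap σ N)
    (a : V) (γ : ℂ) (w : W) :
    M.Xcoeff N a γ w = PolynomialModule.single ℂ 0 (((M.Y a).1 w γ).coeff 0) := by
  ext n
  rcases eq_or_ne n 0 with rfl | hn
  · simp [M.coeff_zero_Xcoeff hdec]
  · simp [M.coeff_Xcoeff hdec a γ w hn, hn.symm]

/-- The modes of `X(a, z)` are the coefficients of `ζ ^ 0` in `Y(a, z)`. -/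
lemma mode_apply {σ N : Module.End ℂ V} (hdec : IsJordanDecomposition φ.toLinearMap σ N)
    (a : V) (m : ℂ) (w : W) : M.mode N a m w = ((M.Y a).1 w (-m - 1)).coeff 0 := by
  rw [mode, LinearMap.comp_apply, M.Xcoeff_eq_single hdec]; simp

/-- `∂_ζ Y(a, z) = -Y(N a, z)`, since `Y(a, z) = X(e^{-ζN} a, z)` and `X` is constant in `ζ`. -/
lemma succ_smul_coeff_succ {σ N : Module.End ℂ V}
    (hdec : IsJordanDecomposition φ.toLinearMap σ N) (a : V) (γ : ℂ) (w : W) (p : ℕ) :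
    ((p : ℂ) + 1) • ((M.Y a).1 w γ).coeff (p + 1) = -((M.Y (N a)).1 w γ).coeff p := by
  obtain ⟨L, hL1, hL⟩ := hdec.locallyNilpotent a
  clear hL1
  induction L generalizing a p with
  | zero => simp only [pow_zero, Module.End.one_apply] at hL; simp [hL]
  | succ L ih =>
    set y : ℕ → ℕ → W := fun l p => ((M.Y ((N ^ l) a)).1 w γ).coeff p with hy
    have hstep : ∀ l p : ℕ, ((p : ℂ) + 1) • y (l + 1) (p + 1) = -y (l + 2) p := fun l p => by
      have h := ih ((N ^ (l + 1)) a) p (by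
        rw [← Module.End.mul_apply, ← pow_add]
        exact pow_apply_eq_zero_of_le hL (by omega))
      rw [← Module.End.mul_apply, ← pow_succ'] at h
      exact h
    have hX : ∑ l ∈ Finset.range (L + 1), ((l.factorial : ℂ)⁻¹) •
        (if l ≤ p + 1 then y l (p + 1 - l) else 0) = 0 := by
      have h := M.coeff_Xcoeff hdec a γ w (Nat.succ_ne_zero p)
      rw [M.Xcoeff_apply hL, PolynomialModule.coeff_sum, Finsupp.finsetSum_apply] at h
      refine (Finset.sum_congr rfl fun l _ => ?_).trans h
      rw [coeff_smul_X_pow_smul]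
      split_ifs <;> simp [hy]
    -- multiplying by `p + 1` makes the terms with `l ≥ 1` telescope
    have htel : ∀ K, ((p : ℂ) + 1) • ∑ l ∈ Finset.range (K + 1), ((l.factorial : ℂ)⁻¹) •
        (if l ≤ p + 1 then y l (p + 1 - l) else 0)
        = ((p : ℂ) + 1) • y 0 (p + 1) + y 1 p
          - ((K.factorial : ℂ)⁻¹) • (if K ≤ p then y (K + 1) (p - K) else 0) := by
      intro K
      induction K with
      | zero => simp
      | succ K ihK =>
        rw [Finset.sum_range_succ, smul_add, ihK]
        rcases lt_trichotomy p K with hK | rfl | hK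
        · simp [show ¬ K ≤ p by omega, show ¬ K + 1 ≤ p by omega]
        · have h1 : ((p + 1).factorial : ℂ) ≠ 0 := Nat.cast_ne_zero.2 (Nat.factorial_ne_zero _)
          simp only [le_refl, if_true, Nat.sub_self, Nat.factorial_succ, Nat.cast_mul, mul_inv,
            smul_smul, show ¬ p + 1 ≤ p by omega, if_false, smul_zero]
          rw [← mul_assoc, Nat.cast_succ, mul_inv_cancel₀ (Nat.cast_add_one_ne_zero p), one_mul]
          abel
        · obtain ⟨q, rfl⟩ : ∃ q, p = K + 1 + q := ⟨p - (K + 1), by omega⟩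
          have hs := hstep K q
          have hf : (K.factorial : ℂ) ≠ 0 := Nat.cast_ne_zero.2 (Nat.factorial_ne_zero _)
          have hK1 : ((K : ℂ) + 1) ≠ 0 := Nat.cast_add_one_ne_zero K
          have hq : ((q : ℂ) + 1) ≠ 0 := Nat.cast_add_one_ne_zero q
          have hs' : y (K + 2) q = -((q : ℂ) + 1) • y (K + 1) (q + 1) := by
            rw [neg_smul, hs, neg_neg]
          rw [if_pos (by omega), if_pos (by omega), if_pos (by omega),
            show K + 1 + q + 1 - (K + 1) = q + 1 by omega, show K + 1 + q - K = q + 1 by omega,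
            show K + 1 + q - (K + 1) = q by omega, show K + 1 + 1 = K + 2 from rfl, hs',
            Nat.factorial_succ]
          push_cast
          match_scalars <;> field_simp
          ring
    have h := htel L
    rw [hX, smul_zero] at h
    have hlast : y (L + 1) (p - L) = 0 := by simp [hy, hL]
    rw [hlast, ite_self, smul_zero, sub_zero] at h
    have : ((p : ℂ) + 1) • y 0 (p + 1) = - y 1 p := eq_neg_of_add_eq_zero_left h.symm
    simpa [hy] using this

/-- For `a ∈ V_α` and `m ∈ α`, the exponents in `Y(a, z)` lie in `-m + ℤ`. -/
lemma exists_int_of_coeff_ne_zero {σ N : Module.End ℂ V}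
    (hdec : IsJordanDecomposition φ.toLinearMap σ N) {m : ℂ} {a : V}
    (ha : a ∈ cosetEigenspace σ (m : CModZ)) {γ : ℂ} {w : W} {p : ℕ}
    (hne : ((M.Y a).1 w γ).coeff p ≠ 0) : ∃ s : ℤ, γ = s - m := by
  induction p generalizing a with
  | zero =>
    have hX : M.Xcoeff N a γ w ≠ 0 := fun h => hne (by
      rw [← M.coeff_zero_Xcoeff hdec, h]; simp)
    have ha' := Module.End.mem_eigenspace_iff.1
      ((Submodule.mem_iInf _).1 ((Submodule.mem_iInf _).1 ha m) rfl)
    have := (eq_and_coeff_eq_zero_of_quasiperiodic Complex.two_pi_I_ne_zero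
      (Complex.exp_ne_zero _) hX (M.monodromy_Xcoeff hdec ha' γ w)).1
    obtain ⟨s, hs⟩ := Complex.exp_eq_exp_iff_exists_int.1 this
    refine ⟨s, ?_⟩
    have h2 := Complex.two_pi_I_ne_zero
    apply mul_left_cancel₀ h2
    rw [hs]; ring
  | succ p ih =>
    refine ih (apply_mem_cosetEigenspace hdec.commute ha) fun h0 => ?_
    have := M.succ_smul_coeff_succ hdec a γ w p
    rw [h0, neg_zero, smul_eq_zero] at this
    exact this.elim (Nat.cast_add_one_ne_zero p) hne

end TwistedModule
end

/-! ### Supports of logarithmic fields -/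

/-- A set of exponents with finitely many elements in every half plane `re γ ≤ x`. -/
def LowerFinite (S : Set ℂ) : Prop := ∀ x : ℝ, {γ ∈ S | γ.re ≤ x}.Finite

lemma LowerFinite.mono {S T : Set ℂ} (hT : LowerFinite T) (h : S ⊆ T) : LowerFinite S :=
  fun x => (hT x).subset fun _ hγ => ⟨h hγ.1, hγ.2⟩

lemma LowerFinite.union {S T : Set ℂ} (hS : LowerFinite S) (hT : LowerFinite T) :
    LowerFinite (S ∪ T) := fun x => ((hS x).union (hT x)).subset fun _ hγ =>
  hγ.1.elim (fun h => Or.inl ⟨h, hγ.2⟩) fun h => Or.inr ⟨h, hγ.2⟩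

lemma LowerFinite.preimage_sub_one {S : Set ℂ} (hS : LowerFinite S) :
    LowerFinite {γ | γ - 1 ∈ S} := fun x =>
  ((hS (x - 1)).preimage (f := fun γ : ℂ => γ - 1) (sub_left_injective.injOn)).subset
    fun γ hγ => ⟨hγ.1, by simpa using hγ.2⟩

lemma LowerFinite.exists_lt_re {S : Set ℂ} (hS : LowerFinite S) :
    ∃ x : ℝ, ∀ γ ∈ S, x < γ.re := by
  obtain ⟨y, hy⟩ := ((hS 0).image Complex.re).bddBelow
  refine ⟨min y 0 - 1, fun γ hγ => ?_⟩
  rcases le_or_gt γ.re 0 with h | h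
  · have := hy ⟨γ, ⟨hγ, h⟩, rfl⟩
    linarith [min_le_left y 0]
  · linarith [min_le_right y 0]

lemma LowerFinite.finite_sub {S T : Set ℂ} (hS : LowerFinite S) (hT : LowerFinite T) (γ : ℂ) :
    {γ₁ | γ₁ ∈ S ∧ γ - γ₁ ∈ T}.Finite := by
  obtain ⟨x, hx⟩ := hT.exists_lt_re
  refine (hS (γ.re - x)).subset fun γ₁ h => ⟨h.1, ?_⟩
  have := hx _ h.2
  rw [Complex.sub_re] at this
  linarith

section
variable {W : Type v} [AddCommGroup W] [Module ℂ W]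

/-- A field of `LF W` is a finite sum of fields with exponents in single cosets, each of which is
truncated from below. -/
lemma lowerFinite_support (A : LF W) (w : W) : LowerFinite {γ | A.1 w γ ≠ 0} := by
  obtain ⟨A, hA⟩ := A
  change LowerFinite {γ | A w γ ≠ 0}
  unfold LF at hA
  induction hA using Submodule.iSup_induction' with
  | mem α A hA =>
    obtain ⟨m, -, hm⟩ := hA w
    intro x
    obtain ⟨n, hn⟩ := exists_nat_ge (x + m.re)
    refine ((Set.finite_le_nat n).image fun i : ℕ => (i : ℂ) - m).subset ?_
    rintro γ ⟨hγ, hx⟩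
    obtain ⟨i, rfl⟩ := hm γ hγ
    refine ⟨i, ?_, rfl⟩
    rw [Complex.sub_re, Complex.natCast_re] at hx
    have : (i : ℝ) ≤ n := by linarith
    exact_mod_cast this
  | zero => exact fun x => by simp
  | add A B _ _ hA hB =>
    refine (hA.union hB).mono fun γ h => ?_
    by_contra hc
    simp only [Set.mem_union, Set.mem_ofPred_eq, not_or, not_not] at hc
    exact h (by simp [hc.1, hc.2])

lemma exists_forall_re_lt (A : LF W) (w : W) : ∃ x : ℝ, ∀ γ : ℂ, γ.re ≤ x → A.1 w γ = 0 := by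
  obtain ⟨x, hx⟩ := (lowerFinite_support A w).exists_lt_re
  exact ⟨x, fun γ h => by_contra fun h' => absurd (hx γ h') (not_lt.2 h)⟩

/-! ### Restriction to the diagonal -/

/-- Finitely many terms of `F` contribute to each coefficient on the diagonal `z₁ = z₂`. -/
def DiagFinite (F : LogSeries₂ W) : Prop :=
  ∀ (γ : ℂ) (p q : ℕ), {γ₁ | F γ₁ (γ - γ₁) p q ≠ 0}.Finite

variable {F G : LogSeries₂ W}

lemma DiagFinite.smul (c : ℂ) (hF : DiagFinite F) : DiagFinite (c • F) := fun γ p q =>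
  (hF γ p q).subset fun γ₁ h h0 => h (by simp [h0])

lemma DiagFinite.mulZ₁₂ (hF : DiagFinite F) : DiagFinite (mulZ₁₂ W F) := fun γ p q => by
  refine (((hF (γ - 1) p q).preimage (f := fun x : ℂ => x - 1) sub_left_injective.injOn).union
    (hF (γ - 1) p q)).subset fun γ₁ h => ?_
  by_contra hc
  simp only [Set.mem_union, Set.mem_preimage, Set.mem_ofPred_eq, not_or, not_not] at hc
  refine h ?_
  have h1 : γ - 1 - (γ₁ - 1) = γ - γ₁ := by ring
  have h2 : γ - 1 - γ₁ = γ - γ₁ - 1 := by ring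
  rw [h1, h2] at hc
  simp [TwistedVertex.mulZ₁₂, hc.1, hc.2]

lemma DiagFinite.Dz₁ (hF : DiagFinite F) : DiagFinite (Dz₁ W F) := fun γ p q => by
  refine (((hF (γ + 1) p q).preimage (f := fun x : ℂ => x + 1) (add_left_injective 1).injOn).union
    ((hF (γ + 1) (p + 1) q).preimage (f := fun x : ℂ => x + 1)
      (add_left_injective 1).injOn)).subset fun γ₁ h => ?_
  by_contra hc
  simp only [Set.mem_union, Set.mem_preimage, Set.mem_ofPred_eq, not_or, not_not] at hc
  refine h ?_
  have h1 : γ + 1 - (γ₁ + 1) = γ - γ₁ := by ring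
  rw [h1] at hc
  simp [TwistedVertex.Dz₁, hc.1, hc.2]

lemma DiagFinite.Dz₁_pow (hF : DiagFinite F) (k : ℕ) : DiagFinite ((TwistedVertex.Dz₁ W ^ k) F) := by
  induction k with
  | zero => simpa using hF
  | succ k ih => rw [pow_succ', Module.End.mul_apply]; exact ih.Dz₁

lemma DiagFinite.finite_support_sum (hF : DiagFinite F) (γ : ℂ) (r : ℕ) :
    (Function.support fun γ₁ => ∑ pq ∈ Finset.HasAntidiagonal.antidiagonal r,
      F γ₁ (γ - γ₁) pq.1 pq.2).Finite := by
  refine (Set.Finite.biUnion (Finset.finite_toSet (Finset.HasAntidiagonal.antidiagonal r))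
    fun pq _ => hF γ pq.1 pq.2).subset fun γ₁ h => ?_
  obtain ⟨pq, hpq, hne⟩ := Finset.exists_ne_zero_of_sum_ne_zero h
  exact Set.mem_biUnion hpq hne

lemma diagCoeff_add (hF : DiagFinite F) (hG : DiagFinite G) (γ : ℂ) (r : ℕ) :
    diagCoeff (F + G) γ r = diagCoeff F γ r + diagCoeff G γ r := by
  rw [diagCoeff, diagCoeff, diagCoeff,
    ← finsum_add_distrib (hF.finite_support_sum γ r) (hG.finite_support_sum γ r)]
  simp only [Pi.add_apply, Finset.sum_add_distrib]

lemma diagCoeff_mulZ₁₂ (hF : DiagFinite F) (γ : ℂ) (r : ℕ) :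
    diagCoeff (mulZ₁₂ W F) γ r = 0 := by
  set g : ℂ → W := fun γ₁ => ∑ pq ∈ Finset.HasAntidiagonal.antidiagonal r,
    F γ₁ (γ - 1 - γ₁) pq.1 pq.2 with hg
  have hgf : (Function.support g).Finite := hF.finite_support_sum (γ - 1) r
  have h1 : diagCoeff (mulZ₁₂ W F) γ r = ∑ᶠ γ₁, (g (γ₁ - 1) - g γ₁) := by
    refine finsum_congr fun γ₁ => ?_
    rw [hg, ← Finset.sum_sub_distrib]
    refine Finset.sum_congr rfl fun pq _ => ?_
    have h1 : γ - 1 - (γ₁ - 1) = γ - γ₁ := by ring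
    have h2 : γ - 1 - γ₁ = γ - γ₁ - 1 := by ring
    rw [h1, h2]; rfl
  rw [h1, finsum_sub_distrib (hgf.preimage (f := fun x : ℂ => x - 1) sub_left_injective.injOn) hgf,
    sub_eq_zero]
  exact finsum_comp_equiv (Equiv.subRight (1 : ℂ))

lemma Dz₁_mulZ₁₂ (F : LogSeries₂ W) : Dz₁ W (mulZ₁₂ W F) = mulZ₁₂ W (Dz₁ W F) + F := by
  funext γ₁ γ₂ p q
  simp only [Dz₁, mulZ₁₂, LinearMap.coe_mk, AddHom.coe_mk, Pi.add_apply, add_sub_cancel_right,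
    sub_add_cancel]
  module

lemma Dz₁_pow_mulZ₁₂ (F : LogSeries₂ W) (k : ℕ) :
    (Dz₁ W ^ (k + 1)) (mulZ₁₂ W F) =
      mulZ₁₂ W ((Dz₁ W ^ (k + 1)) F) + ((k : ℂ) + 1) • (Dz₁ W ^ k) F := by
  induction k with
  | zero => simp [Dz₁_mulZ₁₂]
  | succ k ih =>
    rw [pow_succ' _ (k + 1), Module.End.mul_apply, ih, map_add, Dz₁_mulZ₁₂, map_smul,
      ← Module.End.mul_apply (Dz₁ W), ← Module.End.mul_apply (Dz₁ W), ← pow_succ', ← pow_succ']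
    push_cast
    module

/-- Multiplying by `z₁₂` and differentiating once more does not change the diagonal value, since
`D^{(k+1)} z₁₂ = z₁₂ D^{(k+1)} + D^{(k)}`. -/
lemma diagCoeff_Dz₁_pow_mulZ₁₂ (hF : DiagFinite F) (k : ℕ) (γ : ℂ) (r : ℕ) :
    diagCoeff ((((k + 1).factorial : ℂ)⁻¹) • (Dz₁ W ^ (k + 1)) (mulZ₁₂ W F)) γ r =
      diagCoeff (((k.factorial : ℂ)⁻¹) • (Dz₁ W ^ k) F) γ r := by
  have h : (((k + 1).factorial : ℂ)⁻¹) • (Dz₁ W ^ (k + 1)) (mulZ₁₂ W F) =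
      mulZ₁₂ W ((((k + 1).factorial : ℂ)⁻¹) • (Dz₁ W ^ (k + 1)) F) +
        ((k.factorial : ℂ)⁻¹) • (Dz₁ W ^ k) F := by
    rw [Dz₁_pow_mulZ₁₂, smul_add, map_smul, smul_smul, Nat.factorial_succ]
    congr 2
    have := Nat.cast_ne_zero (R := ℂ).2 k.factorial_ne_zero
    have := Nat.cast_add_one_ne_zero (R := ℂ) k
    push_cast
    field_simp
  rw [h, diagCoeff_add ((hF.Dz₁_pow (k + 1)).smul _).mulZ₁₂ ((hF.Dz₁_pow k).smul _),
    diagCoeff_mulZ₁₂ ((hF.Dz₁_pow (k + 1)).smul _), zero_add]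

/-! ### Products of local fields -/

lemma LocalOfOrder.mono {A B : LF W} {N N' : ℕ} (h : LocalOfOrder N A B) (hN : N ≤ N') :
    LocalOfOrder N' A B := fun v => by
  rw [← Nat.sub_add_cancel hN, pow_add, Module.End.mul_apply, Module.End.mul_apply, h v]

lemma exists_lowerFinite_mulZ₁₂_pow_fst (F : LogSeries₂ W)
    (h : ∃ S, LowerFinite S ∧ ∀ γ₁ γ₂ p q, F γ₁ γ₂ p q ≠ 0 → γ₁ ∈ S) (N : ℕ) :
    ∃ S, LowerFinite S ∧ ∀ γ₁ γ₂ p q, (mulZ₁₂ W ^ N) F γ₁ γ₂ p q ≠ 0 → γ₁ ∈ S := by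
  induction N with
  | zero => simpa using h
  | succ N ih =>
    obtain ⟨S, hS, hF⟩ := ih
    refine ⟨{γ | γ - 1 ∈ S} ∪ S, hS.preimage_sub_one.union hS, fun γ₁ γ₂ p q hne => ?_⟩
    by_contra hc
    simp only [Set.mem_union, Set.mem_ofPred_eq, not_or] at hc
    refine hne ?_
    rw [pow_succ', Module.End.mul_apply]
    change (mulZ₁₂ W ^ N) F (γ₁ - 1) γ₂ p q - (mulZ₁₂ W ^ N) F γ₁ (γ₂ - 1) p q = 0
    rw [not_not.1 (mt (hF _ _ _ _) hc.1), not_not.1 (mt (hF _ _ _ _) hc.2), sub_zero]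

lemma exists_lowerFinite_mulZ₁₂_pow_snd (F : LogSeries₂ W)
    (h : ∃ S, LowerFinite S ∧ ∀ γ₁ γ₂ p q, F γ₁ γ₂ p q ≠ 0 → γ₂ ∈ S) (N : ℕ) :
    ∃ S, LowerFinite S ∧ ∀ γ₁ γ₂ p q, (mulZ₁₂ W ^ N) F γ₁ γ₂ p q ≠ 0 → γ₂ ∈ S := by
  induction N with
  | zero => simpa using h
  | succ N ih =>
    obtain ⟨S, hS, hF⟩ := ih
    refine ⟨{γ | γ - 1 ∈ S} ∪ S, hS.preimage_sub_one.union hS, fun γ₁ γ₂ p q hne => ?_⟩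
    by_contra hc
    simp only [Set.mem_union, Set.mem_ofPred_eq, not_or] at hc
    refine hne ?_
    rw [pow_succ', Module.End.mul_apply]
    change (mulZ₁₂ W ^ N) F (γ₁ - 1) γ₂ p q - (mulZ₁₂ W ^ N) F γ₁ (γ₂ - 1) p q = 0
    rw [not_not.1 (mt (hF _ _ _ _) hc.1), not_not.1 (mt (hF _ _ _ _) hc.2), sub_zero]

/-- `z₁₂ ^ N a(z₁) b(z₂) v` is truncated in `z₂` as it stands, and in `z₁` after the two fields
have been interchanged. -/
lemma LocalOfOrder.diagFinite {A B : LF W} {N : ℕ} (h : LocalOfOrder N A B) (v : W) :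
    DiagFinite ((mulZ₁₂ W ^ N) (comp₁₂ A B v)) := by
  obtain ⟨S, hS, hSF⟩ := exists_lowerFinite_mulZ₁₂_pow_fst (comp₂₁ A B v)
    ⟨_, lowerFinite_support A v, fun γ₁ γ₂ p q hne h0 => hne (by simp [comp₂₁, h0])⟩ N
  obtain ⟨T, hT, hTF⟩ := exists_lowerFinite_mulZ₁₂_pow_snd (comp₁₂ A B v)
    ⟨_, lowerFinite_support B v, fun γ₁ γ₂ p q hne h0 => hne (by simp [comp₁₂, h0])⟩ N
  rw [← h v] at hSF
  exact fun γ p q => (hS.finite_sub hT γ).subset fun γ₁ hne =>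
    ⟨hSF _ _ _ _ hne, hTF _ _ _ _ hne⟩

/-- The coefficients of the `n`-th product as computed with the order of locality `N`. -/
def nthProductCoeff (A B : LF W) (n : ℤ) (v : W) (γ : ℂ) (r N : ℕ) : W :=
  if (N : ℤ) ≤ n then 0 else
    diagCoeff ((((N - 1 - n).toNat.factorial : ℂ)⁻¹) •
      (Dz₁ W ^ (N - 1 - n).toNat) ((mulZ₁₂ W ^ N) (comp₁₂ A B v))) γ r

lemma nthProductCoeff_succ {A B : LF W} {N : ℕ} (h : LocalOfOrder N A B) (n : ℤ) (v : W) (γ : ℂ)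
    (r : ℕ) : nthProductCoeff A B n v γ r (N + 1) = nthProductCoeff A B n v γ r N := by
  unfold nthProductCoeff
  rw [pow_succ' (mulZ₁₂ W), Module.End.mul_apply]
  rcases lt_trichotomy (N : ℤ) n with hn | rfl | hn
  · rw [if_pos (by omega), if_pos (by omega)]
  · rw [if_neg (by omega), if_pos le_rfl]
    rw [show ((N + 1 : ℕ) - 1 - N : ℤ).toNat = 0 by omega, pow_zero, Module.End.one_apply,
      Nat.factorial_zero, Nat.cast_one, inv_one, one_smul]
    exact diagCoeff_mulZ₁₂ (h.diagFinite v) _ _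
  · rw [if_neg (by omega), if_neg (by omega),
      show ((N + 1 : ℕ) - 1 - n : ℤ).toNat = (N - 1 - n : ℤ).toNat + 1 by omega]
    exact diagCoeff_Dz₁_pow_mulZ₁₂ (h.diagFinite v) _ _ _

lemma nthProductCoeff_of_le {A B : LF W} {N N' : ℕ} (h : LocalOfOrder N A B) (hN : N ≤ N') (n : ℤ)
    (v : W) (γ : ℂ) (r : ℕ) : nthProductCoeff A B n v γ r N' = nthProductCoeff A B n v γ r N := by
  induction N', hN using Nat.le_induction with
  | base => rfl
  | succ N' hN ih => rw [nthProductCoeff_succ (h.mono hN), ih]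

/-- The `n`-th product may be computed with any order of locality. -/
lemma IsNthProduct.coeff_eq {A B C : LF W} {n : ℤ} (hC : IsNthProduct A B n C) {N : ℕ}
    (h : LocalOfOrder N A B) (v : W) (γ : ℂ) (r : ℕ) :
    (C.1 v γ).coeff r = nthProductCoeff A B n v γ r N := by
  obtain ⟨N', h', h0, hk⟩ := hC
  rw [← nthProductCoeff_of_le h (le_max_left N N'), nthProductCoeff_of_le h' (le_max_right N N'),
    nthProductCoeff]
  split_ifs with hn
  · rw [h0 hn]; simp
  · exact hk _ (by omega) v γ r

end

/-! ### Binomial expansions in integer modes -/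

lemma finsum_eq_finsum_mem {β W : Type*} [AddCommMonoid W] {S : Set β} {g : β → W}
    (hg : Function.support g ⊆ S) : ∑ᶠ y, g y = ∑ᶠ y ∈ S, g y := by
  rw [finsum_mem_def, Set.indicator_eq_self.2 hg]

lemma finsum_eq_finsum_comp {α β W : Type*} [AddCommMonoid W] {f : α → β}
    (hf : Function.Injective f) {g : β → W} (hg : Function.support g ⊆ Set.range f) :
    ∑ᶠ y, g y = ∑ᶠ x, g (f x) := by
  rw [← finsum_mem_range hf, finsum_eq_finsum_mem hg]

lemma ringChoose_neg_one_sub (K i : ℕ) :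
    Ring.choose (-1 - (K : ℤ)) i = (-1) ^ i * ((K + i).choose K : ℤ) := by
  rw [show (-1 - (K : ℤ)) = -((K : ℤ) + 1) by ring, Ring.choose_neg,
    show (K : ℤ) + 1 + i - 1 = ((K + i : ℕ) : ℤ) by push_cast; ring, Ring.choose_natCast,
    Nat.choose_symm_add, Int.negOnePow_def]
  simp [Units.smul_def]

section
variable (W : Type v) [AddCommGroup W] [Module ℂ W]

/-- Multiplication by `z₁ - z₂` on doubly indexed modes: `F s t` is the coefficient of
`z₁ ^ (-s-1) z₂ ^ (-t-1)`. -/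
def shiftDiff : Module.End ℂ (ℤ → ℤ → W) where
  toFun F := fun s t => F (s + 1) t - F s (t + 1)
  map_add' F G := by
    funext s t
    simp only [Pi.add_apply]
    abel
  map_smul' c F := by
    funext s t
    simp [smul_sub]

variable {W}

lemma shiftDiff_apply (F : ℤ → ℤ → W) (s t : ℤ) :
    shiftDiff W F s t = F (s + 1) t - F s (t + 1) := rfl

lemma shiftDiff_pow_eq_zero {F : ℤ → ℤ → W} {T : ℤ} (hF : ∀ s t, T ≤ t → F s t = 0) (N : ℕ) :
    ∀ s t, T ≤ t → (shiftDiff W ^ N) F s t = 0 := by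
  induction N with
  | zero => simpa using hF
  | succ N ih =>
    intro s t ht
    rw [pow_succ', Module.End.mul_apply, shiftDiff_apply, ih _ _ ht, ih _ _ (by omega), sub_zero]

lemma shiftDiff_pow_swap (F : ℤ → ℤ → W) (N : ℕ) (s t : ℤ) :
    (shiftDiff W ^ N) (fun s t => F t s) s t = (-1 : ℂ) ^ N • (shiftDiff W ^ N) F t s := by
  induction N generalizing s t with
  | zero => simp
  | succ N ih =>
    rw [pow_succ' (shiftDiff W), Module.End.mul_apply, Module.End.mul_apply, shiftDiff_apply,
      shiftDiff_apply, ih, ih, pow_succ]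
    module

lemma support_expansion_subset {F : ℤ → ℤ → W} {T : ℕ}
    (hF : ∀ s t, (T : ℤ) ≤ t → F s t = 0) (c : ℕ → ℂ) (f : ℕ → ℤ) :
    (Function.support fun i : ℕ => c i • F (f i) i) ⊆ (Finset.range T : Finset ℕ) := by
  intro i hi
  rw [Finset.coe_range, Set.mem_Iio]
  by_contra h
  exact hi (by simp only; rw [hF _ _ (by omega), smul_zero])

/-- `i_{z₁,z₂} z₁₂ ^ n = (i_{z₁,z₂} z₁₂ ^ (n-1)) z₁₂`, where `i_{z₁,z₂}` is the expansion in the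
domain `|z₁| > |z₂|`. -/
lemma finsum_expansion_eq_shiftDiff {F : ℤ → ℤ → W} {T : ℕ}
    (hF : ∀ s t, (T : ℤ) ≤ t → F s t = 0) (n : ℤ) :
    ∑ᶠ i : ℕ, ((-1 : ℂ) ^ i * (Ring.choose n i : ℤ)) • F (n - i) i =
      ∑ᶠ i : ℕ, ((-1 : ℂ) ^ i * (Ring.choose (n - 1) i : ℤ)) • shiftDiff W F (n - 1 - i) i := by
  have hF' : ∀ s t, ((T + 1 : ℕ) : ℤ) ≤ t → F s t = 0 := fun s t h => hF s t (by omega)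
  have hD := shiftDiff_pow_eq_zero hF' 1
  rw [pow_one] at hD
  rw [finsum_eq_sum_of_support_subset _ (support_expansion_subset hF' _ fun i => n - i),
    finsum_eq_sum_of_support_subset _ (support_expansion_subset hD _ fun i => n - 1 - i)]
  have key : ∀ k : ℕ,
      ∑ i ∈ Finset.range (k + 1), ((-1 : ℂ) ^ i * (Ring.choose n i : ℤ)) • F (n - i) i =
      ∑ i ∈ Finset.range (k + 1),
        ((-1 : ℂ) ^ i * (Ring.choose (n - 1) i : ℤ)) • shiftDiff W F (n - 1 - i) i
      + ((-1 : ℂ) ^ k * (Ring.choose (n - 1) k : ℤ)) • F (n - 1 - k) (k + 1) := by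
    intro k
    induction k with
    | zero => simp [shiftDiff_apply]
    | succ k ih =>
      have hpascal : Ring.choose n (k + 1) = Ring.choose (n - 1) k + Ring.choose (n - 1) (k + 1) := by
        rw [← Ring.choose_succ_succ, sub_add_cancel]
      rw [Finset.sum_range_succ, ih, Finset.sum_range_succ _ (k + 1), hpascal, shiftDiff_apply,
        show n - 1 - ((k + 1 : ℕ) : ℤ) + 1 = n - 1 - k by push_cast; ring,
        show n - ((k + 1 : ℕ) : ℤ) = n - 1 - k by push_cast; ring,
        show ((k + 1 : ℕ) : ℤ) = k + 1 by push_cast; ring]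
      push_cast
      rw [pow_succ]
      module
  rw [key T, hF _ _ (by omega), smul_zero, add_zero]

lemma finsum_expansion_eq_shiftDiff_pow {F : ℤ → ℤ → W} {T : ℕ}
    (hF : ∀ s t, (T : ℤ) ≤ t → F s t = 0) (n : ℤ) (N : ℕ) :
    ∑ᶠ i : ℕ, ((-1 : ℂ) ^ i * (Ring.choose n i : ℤ)) • F (n - i) i =
      ∑ᶠ i : ℕ, ((-1 : ℂ) ^ i * (Ring.choose (n - N) i : ℤ)) •
        (shiftDiff W ^ N) F (n - N - i) i := by
  induction N with
  | zero => simp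
  | succ N ih =>
    rw [ih, finsum_expansion_eq_shiftDiff (shiftDiff_pow_eq_zero hF N) (n - N)]
    simp only [pow_succ', Module.End.mul_apply, Nat.cast_succ, sub_sub]

/-- The two expansions of `z₁₂ ^ (-1-K)` differ by a derivative of the formal delta function: if
`z₁₂ ^ N F = z₁₂ ^ N G` and `n = N - 1 - K`, then the residue of
`i_{z₁,z₂} z₁₂ ^ n F - i_{z₂,z₁} z₁₂ ^ n G` is the sum of the coefficients of
`(1 / K!) ∂_{z₁} ^ K (z₁₂ ^ N F)` along the diagonal. -/
lemma finsum_expansion_sub_finsum_expansion {F G : ℤ → ℤ → W} {S T : ℕ}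
    (hF : ∀ s t, (T : ℤ) ≤ t → F s t = 0) (hG : ∀ s t, (S : ℤ) ≤ s → G s t = 0)
    {n : ℤ} {N K : ℕ} (hK : (N : ℤ) = n + 1 + K)
    (hFG : (shiftDiff W ^ N) F = (shiftDiff W ^ N) G) :
    ∑ᶠ i : ℕ, ((-1 : ℂ) ^ i * (Ring.choose n i : ℤ)) • F (n - i) i
      - ∑ᶠ i : ℕ, ((-1 : ℂ) ^ (n + i) * (Ring.choose n i : ℤ)) • G i (n - i)
    = ∑ᶠ y : ℤ, ((Ring.choose y K : ℤ) : ℂ) • (shiftDiff W ^ N) F (-1 - y) (y - K) := by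
  set H := (shiftDiff W ^ N) F with hH
  have hn : n - N = -1 - (K : ℤ) := by omega
  have hHT : ∀ s t, (T : ℤ) ≤ t → H s t = 0 := shiftDiff_pow_eq_zero hF N
  have hHS : ∀ t s, (S : ℤ) ≤ s → H s t = 0 := by
    have h := shiftDiff_pow_eq_zero (F := fun s t => G t s) (fun s t h => hG t s h) N
    intro t s hs
    have h1 := h t s hs
    rw [shiftDiff_pow_swap, ← hFG, smul_eq_zero] at h1
    exact h1.resolve_left (by simp)
  set g : ℤ → W := fun y => ((Ring.choose y K : ℤ) : ℂ) • H (-1 - y) (y - K) with hg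
  have hfirst : ∑ᶠ i : ℕ, ((-1 : ℂ) ^ i * (Ring.choose n i : ℤ)) • F (n - i) i
      = ∑ᶠ i : ℕ, g (K + i) := by
    rw [finsum_expansion_eq_shiftDiff_pow hF n N]
    refine finsum_congr fun i => ?_
    rw [hn, ringChoose_neg_one_sub, hg]
    simp only
    rw [show (K : ℤ) + i = ((K + i : ℕ) : ℤ) by push_cast; ring, Ring.choose_natCast]
    push_cast
    rw [← mul_assoc, ← mul_pow, neg_one_mul, neg_neg, one_pow, one_mul, add_sub_cancel_left,
      sub_sub (-1 : ℤ)]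
  have hsecond : ∑ᶠ i : ℕ, ((-1 : ℂ) ^ (n + i) * (Ring.choose n i : ℤ)) • G i (n - i)
      = - ∑ᶠ i : ℕ, g (-1 - i) := by
    have h1 : ∀ i : ℕ, ((-1 : ℂ) ^ (n + i) * (Ring.choose n i : ℤ)) • G i (n - i) =
        (-1 : ℂ) ^ n • (((-1 : ℂ) ^ i * (Ring.choose n i : ℤ)) •
          (fun s t => G t s) (n - i) (i : ℤ)) := fun i => by
      rw [zpow_add₀ (by norm_num), zpow_natCast, smul_smul, mul_assoc]
    rw [finsum_congr h1, ← smul_finsum,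
      finsum_expansion_eq_shiftDiff_pow (fun s t h => hG t s h) n N, smul_finsum,
      ← finsum_neg_distrib]
    refine finsum_congr fun i => ?_
    rw [shiftDiff_pow_swap, ← hFG, hn, ringChoose_neg_one_sub, hg]
    simp only
    rw [ringChoose_neg_one_sub, show -1 - (-1 - (i : ℤ)) = i by ring,
      show -1 - (i : ℤ) - K = -1 - K - i by ring, smul_smul, smul_smul, ← neg_smul,
      add_comm i K, Nat.choose_symm_add]
    congr 1
    have h2 : (-1 : ℂ) ^ n * (-1 : ℂ) ^ N = -(-1) ^ K := by
      rw [← zpow_natCast, ← zpow_add₀ (by norm_num), show n + (N : ℤ) = 2 * n + (1 + K) by omega,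
        zpow_add₀ (by norm_num), zpow_mul, zpow_add₀ (by norm_num)]
      simp
    have h3 : (-1 : ℂ) ^ i * (-1) ^ i = 1 := by rw [← mul_pow]; simp
    push_cast
    linear_combination ((-1 : ℂ) ^ i * (-1) ^ i * ((K + i).choose i : ℂ)) * h2
      - ((-1 : ℂ) ^ K * ((K + i).choose i : ℂ)) * h3
  have hgsupp : Function.support g ⊆
      Set.range (fun i : ℕ => (K : ℤ) + i) ∪ Set.range (fun i : ℕ => -1 - (i : ℤ)) := by
    intro y hy
    rcases lt_or_ge y 0 with h | h
    · exact Or.inr ⟨(-1 - y).toNat, by simp only; omega⟩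
    · refine Or.inl ⟨(y - K).toNat, ?_⟩
      by_contra hc
      simp only at hc
      obtain ⟨z, rfl⟩ := Int.eq_ofNat_of_zero_le h
      refine hy ?_
      simp only [hg]
      rw [Ring.choose_natCast, Nat.choose_eq_zero_of_lt (by omega)]
      simp
  have hgfin : (Function.support g).Finite := by
    refine (Set.finite_Icc (-(S : ℤ)) (T + K)).subset fun y hy => ?_
    constructor
    · by_contra hc
      exact hy (by simp only [hg]; rw [hHS _ _ (by omega), smul_zero])
    · by_contra hc
      exact hy (by simp only [hg]; rw [hHT _ _ (by omega), smul_zero])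
  have hsplit : ∑ᶠ y, g y = ∑ᶠ i : ℕ, g (K + i) + ∑ᶠ i : ℕ, g (-1 - i) := by
    rw [← finsum_mem_range (f := g) (g := fun i : ℕ => (K : ℤ) + i) (fun i j h => by simpa using h),
      ← finsum_mem_range (f := g) (g := fun i : ℕ => -1 - (i : ℤ)) (fun i j h => by simpa using h),
      ← finsum_mem_union' _ (hgfin.subset Set.inter_subset_right)
        (hgfin.subset Set.inter_subset_right)]
    · exact finsum_eq_finsum_mem hgsupp
    · rw [Set.disjoint_left]
      rintro _ ⟨i, rfl⟩ ⟨j, hj⟩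
      simp only at hj
      omega
  rw [hfirst, hsecond, sub_neg_eq_add, ← hsplit]

end

/-! ### Binomial operators -/

section
variable {V : Type u} [AddCommGroup V] [Module ℂ V]

lemma binomOp_eq_choose [BinomialRing (Module.End ℂ V)] (N : Module.End ℂ V) (m : ℂ) (j : ℕ) :
    binomOp N m j = Ring.choose (algebraMap ℂ (Module.End ℂ V) m + N) j := by
  have h := Ring.descPochhammer_eq_factorial_smul_choose (algebraMap ℂ (Module.End ℂ V) m + N) j
  rw [← Polynomial.aeval_eq_smeval, ← Nat.cast_smul_eq_nsmul ℂ] at h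
  rw [binomOp, ← descPochhammer_map (algebraMap ℤ ℂ), Polynomial.aeval_map_algebraMap, h,
    inv_smul_smul₀ (Nat.cast_ne_zero.2 j.factorial_ne_zero)]

/-- The Chu–Vandermonde identity for the commuting operators `y - m - N` and `m + N`, whose sum is
the scalar `y`. -/
lemma sum_binomOp_mul_binomOp (N : Module.End ℂ V) (m : ℂ) (y : ℤ) (K : ℕ) :
    ∑ ij ∈ Finset.HasAntidiagonal.antidiagonal K, binomOp (-N) (y - m) ij.1 * binomOp N m ij.2 =
      ((Ring.choose y K : ℤ) : ℂ) • (1 : Module.End ℂ V) := by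
  let _ : Module ℚ≥0 (Module.End ℂ V) := Module.compHom _ (algebraMap ℚ≥0 ℂ)
  simp only [binomOp_eq_choose]
  rw [← Ring.add_choose_eq]
  · have h : algebraMap ℂ (Module.End ℂ V) (y - m) + -N + (algebraMap ℂ (Module.End ℂ V) m + N) =
        Int.castRingHom (Module.End ℂ V) y := by
      rw [map_sub]
      simp only [map_intCast, eq_intCast]
      abel
    rw [h, ← Ring.map_choose]
    simp [Algebra.smul_def]
  · exact (Algebra.commute_algebraMap_left _ _).add_left
      ((Algebra.commute_algebraMap_right _ _).add_right (Commute.refl N).neg_left)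

lemma binomOp_mem {S : Submodule ℂ V} {N : Module.End ℂ V} (hS : ∀ x ∈ S, N x ∈ S) (m : ℂ) (j : ℕ)
    {x : V} (hx : x ∈ S) : binomOp N m j x ∈ S := by
  refine S.smul_mem _ ?_
  have hS' : ∀ x ∈ S, (algebraMap ℂ (Module.End ℂ V) m + N) x ∈ S := fun x hx =>
    S.add_mem (S.smul_mem m hx) (hS x hx)
  generalize descPochhammer ℂ j = p
  induction p using Polynomial.induction_on' with
  | add p q hp hq => rw [map_add]; exact S.add_mem hp hq
  | monomial n c =>
    rw [Polynomial.aeval_monomial, Module.End.mul_apply]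
    refine S.smul_mem c ?_
    induction n with
    | zero => simpa using hx
    | succ n ih => rw [pow_succ', Module.End.mul_apply]; exact hS' _ ih

end

/-! ### The two-point series of a twisted module -/

section
variable (W : Type v) [AddCommGroup W] [Module ℂ W]

/-- The derivation `∂_{ζ₁}`. -/
def dζ₁ : Module.End ℂ (LogSeries₂ W) where
  toFun F := fun γ₁ γ₂ p q => ((p : ℂ) + 1) • F γ₁ γ₂ (p + 1) q
  map_add' F G := by
    funext γ₁ γ₂ p q
    simp only [Pi.add_apply, smul_add]
  map_smul' c F := by
    funext γ₁ γ₂ p q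
    simp only [Pi.smul_apply, RingHom.id_apply, smul_comm c]

lemma commute_mulZ₁₂_dζ₁ : Commute (mulZ₁₂ W) (dζ₁ W) := by
  ext F γ₁ γ₂ p q
  simp [mulZ₁₂, dζ₁, smul_sub]

variable {W}

lemma mulZ₁₂_pow_dζ₁ (N : ℕ) (F : LogSeries₂ W) :
    (mulZ₁₂ W ^ N) (dζ₁ W F) = dζ₁ W ((mulZ₁₂ W ^ N) F) := by
  rw [← Module.End.mul_apply, ((commute_mulZ₁₂_dζ₁ W).pow_left N).eq, Module.End.mul_apply]

/-- On a family of series with `∂_{ζ₁} F a = -F (N a)`, the operator `D_{z₁}^{(K)}` acts as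
`binom(γ₁ - N, K)` on the coefficient of `z₁ ^ γ₁`. -/
lemma Dz₁_pow_apply {V : Type u} [AddCommGroup V] [Module ℂ V] (F : V →ₗ[ℂ] LogSeries₂ W)
    (N : Module.End ℂ V) (hF : ∀ c, dζ₁ W (F c) = -F (N c)) (K : ℕ) (c : V) (γ₁ γ₂ : ℂ)
    (p q : ℕ) : (((K.factorial : ℂ)⁻¹) • (Dz₁ W ^ K) (F c)) γ₁ γ₂ p q =
      F (binomOp (-N) (γ₁ + K) K c) (γ₁ + K) γ₂ p q := by
  have key : ∀ γ₁ p, (Dz₁ W ^ K) (F c) γ₁ γ₂ p q =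
      F (Polynomial.aeval (algebraMap ℂ (Module.End ℂ V) (γ₁ + K) + -N) (descPochhammer ℂ K) c)
        (γ₁ + K) γ₂ p q := by
    induction K with
    | zero => simp
    | succ K ih =>
      intro γ₁ p
      set x := Polynomial.aeval (algebraMap ℂ (Module.End ℂ V) (γ₁ + 1 + K) + -N)
        (descPochhammer ℂ K) c with hx
      have h1 : (Dz₁ W ^ (K + 1)) (F c) γ₁ γ₂ p q =
          (γ₁ + 1) • F x (γ₁ + 1 + K) γ₂ p q - F (N x) (γ₁ + 1 + K) γ₂ p q := by
        rw [pow_succ', Module.End.mul_apply]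
        change (γ₁ + 1) • (Dz₁ W ^ K) (F c) (γ₁ + 1) γ₂ p q +
          ((p : ℂ) + 1) • (Dz₁ W ^ K) (F c) (γ₁ + 1) γ₂ (p + 1) q = _
        rw [ih, ih, sub_eq_add_neg]
        congr 1
        exact congrFun (congrFun (congrFun (congrFun (hF x) _) _) _) _
      have h2 : Polynomial.aeval (algebraMap ℂ (Module.End ℂ V) (γ₁ + (K + 1 : ℕ)) + -N)
          (descPochhammer ℂ (K + 1)) c = (γ₁ + 1) • x - N x := by
        rw [descPochhammer_succ_right, mul_comm, map_mul, Module.End.mul_apply,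
          show γ₁ + ((K + 1 : ℕ) : ℂ) = γ₁ + 1 + K by push_cast; ring, ← hx]
        simp [add_smul]
        module
      rw [h1, h2, map_sub, map_smul, show γ₁ + ((K + 1 : ℕ) : ℂ) = γ₁ + 1 + K by push_cast; ring]
      rfl
  rw [binomOp, LinearMap.smul_apply, map_smul]
  exact congrArg _ (key γ₁ p)

lemma mulZ₁₂_pow_support {P : ℂ → Prop} (hP : ∀ γ, P (γ - 1) → P γ) {F : LogSeries₂ W}
    (hF : ∀ γ₁ γ₂ p q, F γ₁ γ₂ p q ≠ 0 → P γ₁) (N : ℕ) (γ₁ γ₂ : ℂ) (p q : ℕ)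
    (hne : (mulZ₁₂ W ^ N) F γ₁ γ₂ p q ≠ 0) : P γ₁ := by
  induction N generalizing γ₁ γ₂ with
  | zero => exact hF _ _ _ _ (by simpa using hne)
  | succ N ih =>
    by_contra hc
    refine hne ?_
    rw [pow_succ', Module.End.mul_apply]
    change (mulZ₁₂ W ^ N) F (γ₁ - 1) γ₂ p q - (mulZ₁₂ W ^ N) F γ₁ (γ₂ - 1) p q = 0
    rw [not_not.1 (mt (ih (γ₁ - 1) γ₂) fun h => hc (hP _ h)), not_not.1 (mt (ih _ _) hc), sub_zero]

lemma shiftDiff_pow_restrict (F : LogSeries₂ W) (m k : ℂ) (N : ℕ) (s t : ℤ) :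
    (shiftDiff W ^ N) (fun s t => F (-(m + s) - 1) (-(k + t) - 1) 0 0) s t =
      (mulZ₁₂ W ^ N) F (-(m + s) - 1) (-(k + t) - 1) 0 0 := by
  induction N generalizing s t with
  | zero => simp
  | succ N ih =>
    rw [pow_succ' (shiftDiff W), pow_succ' (mulZ₁₂ W), Module.End.mul_apply, Module.End.mul_apply,
      shiftDiff_apply, ih, ih]
    change _ = (mulZ₁₂ W ^ N) F (-(m + s) - 1 - 1) (-(k + t) - 1) 0 0 -
      (mulZ₁₂ W ^ N) F (-(m + s) - 1) (-(k + t) - 1 - 1) 0 0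
    rw [show -(m + ((s + 1 : ℤ) : ℂ)) - 1 = -(m + s) - 1 - 1 by push_cast; ring,
      show -(k + ((t + 1 : ℤ) : ℂ)) - 1 = -(k + t) - 1 - 1 by push_cast; ring]

end

section
variable {V : Type u} [AddCommGroup V] [Module ℂ V] {𝒱 : VertexAlgebra V} {φ : V ≃ₗ[ℂ] V}
  {W : Type v} [AddCommGroup W] [Module ℂ W]

namespace TwistedModule
variable (M : TwistedModule 𝒱 φ W) {σ N : Module.End ℂ V}

/-- `z₁₂ ^ L Y(a, z₁) Y(b, z₂) v` as a linear function of `a`. -/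
def twoPoint (b : V) (v : W) (L : ℕ) : V →ₗ[ℂ] LogSeries₂ W :=
  (mulZ₁₂ W ^ L) ∘ₗ
    { toFun := fun a => comp₁₂ (M.Y a) (M.Y b) v
      map_add' := fun a a' => by funext γ₁ γ₂ p q; simp [comp₁₂]
      map_smul' := fun c a => by funext γ₁ γ₂ p q; simp [comp₁₂, coeff_smul_eq] }

/-- `z₁₂ ^ L Y(b, z₂) Y(a, z₁) v` as a linear function of `a`. -/
def twoPointSwap (b : V) (v : W) (L : ℕ) : V →ₗ[ℂ] LogSeries₂ W :=
  (mulZ₁₂ W ^ L) ∘ₗ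
    { toFun := fun a => comp₂₁ (M.Y a) (M.Y b) v
      map_add' := fun a a' => by funext γ₁ γ₂ p q; simp [comp₂₁]
      map_smul' := fun c a => by funext γ₁ γ₂ p q; simp [comp₂₁, coeff_smul_eq] }

lemma twoPoint_apply (a b : V) (v : W) (L : ℕ) :
    M.twoPoint b v L a = (mulZ₁₂ W ^ L) (comp₁₂ (M.Y a) (M.Y b) v) := rfl

lemma twoPointSwap_apply (a b : V) (v : W) (L : ℕ) :
    M.twoPointSwap b v L a = (mulZ₁₂ W ^ L) (comp₂₁ (M.Y a) (M.Y b) v) := rfl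

lemma dζ₁_twoPoint (hdec : IsJordanDecomposition φ.toLinearMap σ N) (b : V) (v : W) (L : ℕ)
    (a : V) : dζ₁ W (M.twoPoint b v L a) = -M.twoPoint b v L (N a) := by
  have h : dζ₁ W (comp₁₂ (M.Y a) (M.Y b) v) = -comp₁₂ (M.Y (N a)) (M.Y b) v := by
    funext γ₁ γ₂ p q
    exact M.succ_smul_coeff_succ hdec a _ _ p
  rw [twoPoint_apply, ← mulZ₁₂_pow_dζ₁, h, map_neg, twoPoint_apply]

lemma dζ₁_twoPointSwap (hdec : IsJordanDecomposition φ.toLinearMap σ N) (b : V) (v : W) (L : ℕ)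
    (a : V) : dζ₁ W (M.twoPointSwap b v L a) = -M.twoPointSwap b v L (N a) := by
  have h : dζ₁ W (comp₂₁ (M.Y a) (M.Y b) v) = -comp₂₁ (M.Y (N a)) (M.Y b) v := by
    funext γ₁ γ₂ p q
    have h := M.succ_smul_coeff_succ hdec a γ₁ v p
    change ((p : ℂ) + 1) • ((M.Y b).1 (((M.Y a).1 v γ₁).coeff (p + 1)) γ₂).coeff q =
      -((M.Y b).1 (((M.Y (N a)).1 v γ₁).coeff p) γ₂).coeff q
    rw [eq_neg_iff_add_eq_zero] at h ⊢
    have h2 := congrArg (fun w => ((M.Y b).1 w γ₂).coeff q) h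
    simpa [coeff_smul_eq] using h2
  rw [twoPointSwap_apply, ← mulZ₁₂_pow_dζ₁, h, map_neg, twoPointSwap_apply]

/-- The vectors whose fields are local to `Y(b, z)` of order `L`. -/
def localSubmodule (b : V) (L : ℕ) : Submodule ℂ V :=
  ⨅ v, LinearMap.eqLocus (M.twoPoint b v L) (M.twoPointSwap b v L)

lemma mem_localSubmodule {a b : V} {L : ℕ} :
    a ∈ M.localSubmodule b L ↔ LocalOfOrder L (M.Y a) (M.Y b) := by
  simp only [localSubmodule, Submodule.mem_iInf, LinearMap.mem_eqLocus]
  rfl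

/-- `Y(N a, z) = -∂_ζ Y(a, z)`, and `∂_{ζ₁}` commutes with `z₁₂`. -/
lemma apply_mem_localSubmodule (hdec : IsJordanDecomposition φ.toLinearMap σ N) {a b : V} {L : ℕ}
    (ha : a ∈ M.localSubmodule b L) : N a ∈ M.localSubmodule b L := by
  simp only [localSubmodule, Submodule.mem_iInf, LinearMap.mem_eqLocus] at ha ⊢
  intro v
  have h := congrArg (dζ₁ W) (ha v)
  rw [M.dζ₁_twoPoint hdec, M.dζ₁_twoPointSwap hdec] at h
  exact neg_injective h

lemma twoPoint_support (hdec : IsJordanDecomposition φ.toLinearMap σ N) {m : ℂ} {c : V}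
    (hc : c ∈ cosetEigenspace σ (m : CModZ)) (b : V) (v : W) (L : ℕ) (γ₁ γ₂ : ℂ) (p q : ℕ)
    (hne : M.twoPoint b v L c γ₁ γ₂ p q ≠ 0) : ∃ s : ℤ, γ₁ = s - m := by
  refine mulZ₁₂_pow_support (P := fun γ => ∃ s : ℤ, γ = s - m) ?_ ?_ L γ₁ γ₂ p q hne
  · rintro γ ⟨s, hs⟩
    exact ⟨s + 1, by push_cast; linear_combination hs⟩
  · exact fun γ₁ γ₂ p q h => M.exists_int_of_coeff_ne_zero hdec hc h

lemma mode_prod_eq_zero (hdec : IsJordanDecomposition φ.toLinearMap σ N) {c b : V} {L : ℕ}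
    (hloc : c ∈ M.localSubmodule b L) {n : ℤ} (hn : (L : ℤ) ≤ n) (v : W) (δ : ℂ) :
    M.mode N (𝒱.prod n c b) δ v = 0 := by
  rw [M.mode_apply hdec, (M.nthProduct c b n).coeff_eq (M.mem_localSubmodule.1 hloc),
    nthProductCoeff, if_pos hn]

/-- The modes of `c_(n) b` for `c ∈ V_α` and `m ∈ α`, as sums over integers along the diagonal. -/
lemma mode_prod (hdec : IsJordanDecomposition φ.toLinearMap σ N) {m : ℂ} {c b : V}
    (hc : c ∈ cosetEigenspace σ (m : CModZ)) {L : ℕ} (hloc : c ∈ M.localSubmodule b L) {n : ℤ}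
    {K : ℕ} (hK : (K : ℤ) = L - 1 - n) (v : W) (δ : ℂ) :
    (Function.support fun y : ℤ =>
      M.twoPoint b v L (binomOp (-N) (y - m) K c) (y - m) (K - 1 - δ + m - y) 0 0).Finite ∧
    M.mode N (𝒱.prod n c b) δ v = ∑ᶠ y : ℤ,
      M.twoPoint b v L (binomOp (-N) (y - m) K c) (y - m) (K - 1 - δ + m - y) 0 0 := by
  set g : ℂ → W := fun γ₁ =>
    (((K.factorial : ℂ)⁻¹) • (Dz₁ W ^ K) (M.twoPoint b v L c)) γ₁ (-δ - 1 - γ₁) 0 0 with hg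
  have hgfin : (Function.support g).Finite :=
    (((M.mem_localSubmodule.1 hloc).diagFinite v).Dz₁_pow K).smul _ (-δ - 1) 0 0
  have hinj : Function.Injective fun y : ℤ => (y : ℂ) - m - K := fun y y' h => by simpa using h
  have hgy : ∀ γ, g γ = M.twoPoint b v L (binomOp (-N) (γ + K) K c) (γ + K) (-δ - 1 - γ) 0 0 :=
    fun γ => Dz₁_pow_apply _ N (M.dζ₁_twoPoint hdec b v L) K c _ _ 0 0
  have hcomp : ∀ y : ℤ, M.twoPoint b v L (binomOp (-N) (y - m) K c) (y - m)
      (K - 1 - δ + m - y) 0 0 = g (y - m - K) := fun y => by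
    rw [hgy, sub_add_cancel, show -δ - 1 - ((y : ℂ) - m - K) = K - 1 - δ + m - y by ring]
  have hNc : ∀ x ∈ cosetEigenspace σ (m : CModZ), (-N) x ∈ cosetEigenspace σ (m : CModZ) :=
    fun x hx => neg_mem (apply_mem_cosetEigenspace hdec.commute hx)
  have hrange : Function.support g ⊆ Set.range fun y : ℤ => (y : ℂ) - m - K := fun γ hγ => by
    rw [Function.mem_support, hgy] at hγ
    obtain ⟨s, hs⟩ := M.twoPoint_support hdec (binomOp_mem hNc _ K hc) b v L _ _ _ _ hγ
    exact ⟨s, by simp only; rw [← hs]; ring⟩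
  constructor
  · simp only [hcomp]
    exact hgfin.preimage hinj.injOn
  · simp only [hcomp]
    rw [← finsum_eq_finsum_comp hinj hrange, M.mode_apply hdec,
      (M.nthProduct c b n).coeff_eq (M.mem_localSubmodule.1 hloc), nthProductCoeff,
      if_neg (by omega), ← hK, Int.toNat_natCast, diagCoeff]
    refine finsum_congr fun γ => ?_
    simp [hg, twoPoint_apply]

/-- Modes vanish on a given vector for large integer shifts of the index. -/
lemma exists_mode_eq_zero (hdec : IsJordanDecomposition φ.toLinearMap σ N) (a : V) (m : ℂ)
    (w : W) : ∃ T : ℕ, ∀ t : ℤ, (T : ℤ) ≤ t → M.mode N a (m + t) w = 0 := by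
  obtain ⟨x, hx⟩ := exists_forall_re_lt (M.Y a) w
  obtain ⟨T, hT⟩ := exists_nat_ge (-m.re - 1 - x)
  refine ⟨T, fun t ht => ?_⟩
  rw [M.mode_apply hdec, hx]
  · simp
  · have : (T : ℝ) ≤ t := by exact_mod_cast ht
    simp only [Complex.sub_re, Complex.neg_re, Complex.add_re, Complex.intCast_re, Complex.one_re]
    linarith

lemma finite_support_expansion (hdec : IsJordanDecomposition φ.toLinearMap σ N) (b : V) (k : ℂ)
    (v : W) (c : ℕ → ℂ) (f : ℕ → Module.End ℂ W) :
    (Function.support fun i : ℕ => c i • f i (M.mode N b (k + i) v)).Finite := by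
  obtain ⟨T, hT⟩ := M.exists_mode_eq_zero hdec b k v
  refine (Set.finite_lt_nat T).subset fun i hi => ?_
  by_contra h
  refine hi ?_
  have := hT i (by simpa using h)
  rw [Int.cast_natCast] at this
  simp [this]

/-- The right-hand side of the Borcherds identity, summed by the Vandermonde identity
`∑ binom(y - m - N, K - j) binom(m + N, j) = binom(y, K)`. -/
lemma finsum_mode_prod (hdec : IsJordanDecomposition φ.toLinearMap σ N) {m : ℂ} {a b : V}
    (ha : a ∈ cosetEigenspace σ (m : CModZ)) {L : ℕ} (hloc : a ∈ M.localSubmodule b L) {n : ℤ}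
    {K : ℕ} (hK : (L : ℤ) = n + 1 + K) (k : ℂ) (v : W) :
    (Function.support fun j : ℕ =>
      M.mode N (𝒱.prod (n + j) (binomOp N m j a) b) (m + k - j) v).Finite ∧
    ∑ᶠ j : ℕ, M.mode N (𝒱.prod (n + j) (binomOp N m j a) b) (m + k - j) v =
      ∑ᶠ y : ℤ, ((Ring.choose y K : ℤ) : ℂ) •
        M.twoPoint b v L a (y - m) (K - 1 - k - y) 0 0 := by
  have hloc' : ∀ j, binomOp N m j a ∈ M.localSubmodule b L := fun j =>
    binomOp_mem (fun x hx => M.apply_mem_localSubmodule hdec hx) m j hloc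
  have ha' : ∀ j, binomOp N m j a ∈ cosetEigenspace σ (m : CModZ) := fun j =>
    binomOp_mem (fun x hx => apply_mem_cosetEigenspace hdec.commute hx) m j ha
  have hsub : (Function.support fun j : ℕ =>
      M.mode N (𝒱.prod (n + j) (binomOp N m j a) b) (m + k - j) v) ⊆
      (Finset.range (K + 1) : Finset ℕ) := fun j hj => by
    rw [Finset.coe_range, Set.mem_Iio]
    by_contra h
    exact hj (M.mode_prod_eq_zero hdec (hloc' j) (by omega) _ _)
  refine ⟨(Finset.finite_toSet _).subset hsub, ?_⟩
  have hterm : ∀ ij ∈ Finset.HasAntidiagonal.antidiagonal K,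
      (Function.support fun y : ℤ => M.twoPoint b v L
        (binomOp (-N) (y - m) ij.1 (binomOp N m ij.2 a)) (y - m) (K - 1 - k - y) 0 0).Finite ∧
      M.mode N (𝒱.prod (n + ij.2) (binomOp N m ij.2 a) b) (m + k - ij.2) v =
      ∑ᶠ y : ℤ, M.twoPoint b v L
        (binomOp (-N) (y - m) ij.1 (binomOp N m ij.2 a)) (y - m) (K - 1 - k - y) 0 0 := by
    rintro ⟨i, j⟩ hij
    have hij' : i + j = K := Finset.HasAntidiagonal.mem_antidiagonal.1 hij
    have h := M.mode_prod hdec (ha' j) (hloc' j) (n := n + j) (K := i) (by omega) v (m + k - j)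
    have he : ∀ y : ℤ, (i : ℂ) - 1 - (m + k - j) + m - y = K - 1 - k - y := fun y => by
      rw [← hij']; push_cast; ring
    simp only [he] at h
    exact h
  rw [finsum_eq_sum_of_support_subset _ hsub,
    ← Finset.Nat.sum_antidiagonal_eq_sum_range_succ_mk
      (f := fun ij => M.mode N (𝒱.prod (n + ij.1) (binomOp N m ij.1 a) b) (m + k - ij.1) v),
    ← Finset.Nat.sum_antidiagonal_swap]
  simp only [Prod.fst_swap]
  rw [Finset.sum_congr rfl fun ij hij => (hterm ij hij).2,
    ← finsum_sum_comm _ _ fun ij hij => (hterm ij hij).1]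
  refine finsum_congr fun y => ?_
  have h := congrArg (fun f : Module.End ℂ V =>
    M.twoPoint b v L (f a) (y - m) (K - 1 - k - y) 0 0) (sum_binomOp_mul_binomOp N m y K)
  simpa [LinearMap.sum_apply, map_sum, Finset.sum_apply] using h

/-- The Borcherds identity: both sides are the residue on the diagonal of
`(1 / K!) z₂ ^ k ∂_{z₁} ^ K (z₁ ^ m z₁₂ ^ L Y(a, z₁) Y(b, z₂) v)`, where `n = L - 1 - K`. -/
lemma borcherds (hdec : IsJordanDecomposition φ.toLinearMap σ N) {m : ℂ} {a : V}
    (ha : a ∈ cosetEigenspace σ (m : CModZ)) (b : V) (k : ℂ) (n : ℤ) (v : W) :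
    (Function.support fun j : ℕ =>
      M.mode N (𝒱.prod (n + j) (binomOp N m j a) b) (m + k - j) v).Finite ∧
    ∑ᶠ i : ℕ, ((-1 : ℂ) ^ i * (Ring.choose n i : ℤ)) •
        M.mode N a (m + n - i) (M.mode N b (k + i) v)
      - ∑ᶠ i : ℕ, ((-1 : ℂ) ^ (n + i) * (Ring.choose n i : ℤ)) •
        M.mode N b (k + n - i) (M.mode N a (m + i) v)
      = ∑ᶠ j : ℕ, M.mode N (𝒱.prod (n + j) (binomOp N m j a) b) (m + k - j) v := by
  obtain ⟨L₀, hL₀⟩ := M.isLocal a b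
  -- the order of locality is taken larger than `n`, so that `K = L - 1 - n` is nonnegative
  obtain ⟨L, K, hL, hK⟩ : ∃ L K : ℕ, L₀ ≤ L ∧ (L : ℤ) = n + 1 + K :=
    ⟨max L₀ (n + 1).toNat, (max L₀ (n + 1).toNat - (n + 1)).toNat, le_max_left _ _, by omega⟩
  have hloc : LocalOfOrder L (M.Y a) (M.Y b) := hL₀.mono hL
  obtain ⟨T, hT⟩ := M.exists_mode_eq_zero hdec b k v
  obtain ⟨S, hS⟩ := M.exists_mode_eq_zero hdec a m v
  set F : ℤ → ℤ → W := fun s t => M.mode N a (m + s) (M.mode N b (k + t) v) with hF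
  set G : ℤ → ℤ → W := fun s t => M.mode N b (k + t) (M.mode N a (m + s) v) with hG
  have hFr : F = fun s t : ℤ =>
      comp₁₂ (M.Y a) (M.Y b) v (-(m + s) - 1) (-(k + t) - 1) 0 0 := by
    funext s t
    simp only [hF, M.mode_apply hdec, comp₁₂]
  have hGr : G = fun s t : ℤ =>
      comp₂₁ (M.Y a) (M.Y b) v (-(m + s) - 1) (-(k + t) - 1) 0 0 := by
    funext s t
    simp only [hG, M.mode_apply hdec, comp₂₁]
  have hFG : (shiftDiff W ^ L) F = (shiftDiff W ^ L) G := by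
    funext s t
    rw [hFr, hGr, shiftDiff_pow_restrict, shiftDiff_pow_restrict, hloc v]
  have hmain := finsum_expansion_sub_finsum_expansion (F := F) (G := G) (S := S) (T := T)
    (fun s t ht => by simp only [hF]; rw [hT t ht, map_zero])
    (fun s t hs => by simp only [hG]; rw [hS s hs, map_zero]) hK hFG
  obtain ⟨hfin, hrhs⟩ := M.finsum_mode_prod hdec ha (M.mem_localSubmodule.2 hloc) hK k v
  refine ⟨hfin, ?_⟩
  rw [hrhs]
  have h1 : ∀ i : ℕ, M.mode N a (m + n - i) (M.mode N b (k + i) v) = F (n - i) i := fun i => by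
    simp only [hF]; push_cast; rw [add_sub_assoc]
  have h2 : ∀ i : ℕ, M.mode N b (k + n - i) (M.mode N a (m + i) v) = G i (n - i) := fun i => by
    simp only [hG]; push_cast; rw [add_sub_assoc]
  simp only [h1, h2]
  rw [hmain]
  refine finsum_congr fun y => ?_
  rw [hFr, shiftDiff_pow_restrict, twoPoint_apply,
    show -(m + ((-1 - y : ℤ) : ℂ)) - 1 = y - m by push_cast; ring,
    show -(k + ((y - K : ℤ) : ℂ)) - 1 = K - 1 - k - y by push_cast; ring]

end TwistedModule
end
end TwistedVertex

end

open TwistedVertex in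
theorem theorem5p1 {V : Type*} [AddCommGroup V] [Module ℂ V] (𝒱 : VertexAlgebra V)
    (φ : V ≃ₗ[ℂ] V) (hφ : IsAutomorphism 𝒱 φ) (hfin : IsLocallyFinite φ.toLinearMap)
    (σ N : Module.End ℂ V) (hdec : IsJordanDecomposition φ.toLinearMap σ N)
    {W : Type*} [AddCommGroup W] [Module ℂ W] (M : TwistedModule 𝒱 φ W) :
    -- the coefficients of `X(a, z)` do not depend on `ζ`, so that the modes are well defined
    (∀ (a : V) (m : ℂ) (v : W),
      M.Xcoeff N a (-m - 1) v = PolynomialModule.single ℂ 0 (M.mode N a m v)) ∧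
    -- the Borcherds identity, in which all three sums are finite
    (∀ (α β : CModZ) (a b : V), a ∈ cosetEigenspace σ α → b ∈ cosetEigenspace σ β →
      ∀ (m k : ℂ), (m : CModZ) = α → (k : CModZ) = β → ∀ (n : ℤ) (v : W),
      (Function.support fun i : ℕ => ((-1 : ℂ) ^ i * (Ring.choose n i : ℤ)) •
          M.mode N a (m + n - i) (M.mode N b (k + i) v)).Finite ∧
      (Function.support fun i : ℕ => ((-1 : ℂ) ^ (n + i) * (Ring.choose n i : ℤ)) •
          M.mode N b (k + n - i) (M.mode N a (m + i) v)).Finite ∧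
      (Function.support fun j : ℕ =>
          M.mode N (𝒱.prod (n + j) (binomOp N m j a) b) (m + k - j) v).Finite ∧
      ∑ᶠ i : ℕ, ((-1 : ℂ) ^ i * (Ring.choose n i : ℤ)) •
            M.mode N a (m + n - i) (M.mode N b (k + i) v)
          - ∑ᶠ i : ℕ, ((-1 : ℂ) ^ (n + i) * (Ring.choose n i : ℤ)) •
            M.mode N b (k + n - i) (M.mode N a (m + i) v)
        = ∑ᶠ j : ℕ, M.mode N (𝒱.prod (n + j) (binomOp N m j a) b) (m + k - j) v) ∧
    -- the commutator formula
    (∀ (α β : CModZ) (a b : V), a ∈ cosetEigenspace σ α → b ∈ cosetEigenspace σ β →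
      ∀ (m k : ℂ), (m : CModZ) = α → (k : CModZ) = β → ∀ v : W,
      (Function.support fun j : ℕ =>
          M.mode N (𝒱.prod j (binomOp N m j a) b) (m + k - j) v).Finite ∧
      M.mode N a m (M.mode N b k v) - M.mode N b k (M.mode N a m v)
        = ∑ᶠ j : ℕ, M.mode N (𝒱.prod j (binomOp N m j a) b) (m + k - j) v) := by
  refine ⟨fun a m v => ?_, ?_, ?_⟩
  · rw [M.mode_apply hdec, M.Xcoeff_eq_single hdec]
  · rintro α β a b ha hb m k rfl rfl n v
    obtain ⟨h1, h2⟩ := M.borcherds hdec ha b k n v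
    exact ⟨M.finite_support_expansion hdec b k v _ fun i => M.mode N a (m + n - i),
      M.finite_support_expansion hdec a m v _ fun i => M.mode N b (k + n - i), h1, h2⟩
  · rintro α β a b ha hb m k rfl rfl v
    have h := M.borcherds hdec ha b k 0 v
    simp only [zero_add] at h
    refine ⟨h.1, h.2 ▸ ?_⟩
    rw [finsum_eq_single _ 0 (fun i hi => by
        rw [Ring.choose_zero_pos _ (Nat.pos_of_ne_zero hi)]; simp),
      finsum_eq_single _ 0 (fun i hi => by
        rw [Ring.choose_zero_pos _ (Nat.pos_of_ne_zero hi)]; simp)]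
    simp
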